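/- Let $q$ be a prime power, $F=\mathbb F_{q^2}$, and let $F[x,y]=F[X,Y]/(X^{q+1}-Y^q-Y)$ be the coordinate ring of the Hermitian curve, with quotient field $F(x,y)$. The monomials $x^ay^b$ ($a\ge 0$, $0\le b<q$) form an $F$-basis of $F[x,y]$; write $h_{a,b}$ for the coefficients of $h\in F[x,y]$ in it. Put $\rho(h)=\max\{aq+b(q+1): h_{a,b}\ne 0\}$, $\rho(0)=-\infty$, and extend to $F(x,y)$ by $\rho(h/h')=\rho(h)-\rho(h')$. Let $z^*_0=y^{q-1}+1$ and $z^*_b=y^{q-1-b}$ for $0<b<q$. Every element of $F(x,y)$ is uniquely $\sum_{b=0}^{q-1}h_bz^*_b$ with $h_b\in F(x)$; expanding each $h_b$ as a Laurent series in $1/x$ writes it as a sum of terms $c\,x^az^*_b$ ($a\in\mathbb Z$, $c\in F$) of order $aq+q^2-1-b(q+1)$. An element is called monic if its term of largest order has coefficient $1$. Let $e=(e_P)$ be a vector over $F$ indexed by the $q^3$ points $P=(\alpha_P,\beta_P)\in F^2$ with $\alpha_P^{q+1}=\beta_P^q+\beta_P$. Put $s_{a,b}=\sum_P e_P\alpha_P^a\beta_P^b$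 for $a\ge 0$ (with $0^0=1$), $s_{a,b}=0$ for $a<0$, and $$S=\sum_P e_P\frac{x^{q+1}-\alpha_P^{q+1}}{(x-\alpha_P)(y-\beta_P)}\in F(x,y).$$ For $K\in\mathbb Z$, a pair $f,\varphi\in F[x,y]$ with $f\neq 0$ solves the $K$-th approximation of the key equation if $\rho(fS-\varphi)\le q^2-q-1-K$ and $\varphi$, written in the basis $(z^*_b)$, is a sum of terms of order at least $q^2-q-K$. By convention, the pairs $0,\ \pm x^{-a-1}z^*_b$ with $a<0$, $0\le b<q$ also solve it, for $K=aq+b(q+1)$, and no other pair with $f=0$ does. Define $f_i^{(m)},\varphi_i^{(m)},g_i^{(m)},\psi_i^{(m)}\in F[x,y]$ for $m\ge 0$, $0\le i<q$, as follows. Initially $f_i^{(0)}=y^i$, $\varphi_i^{(0)}=0$, $g_i^{(0)}=0$, $\psi_i^{(0)}=-z^*_i$. Given the data for $m$, for each $i$ let $j\in\{0,\dots,q-1\}$ be the index with $i+j\equiv m \pmod q$, and let $$d_i=\rho(f_i^{(m)}),\quad r_i=\frac{m-d_i-j(q+1)}{q},\quad \tilde f_i=y^jf_i^{(m)},\quad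 \mu_i=\sum_{c=0}^{q-1}\sum_a(\tilde f_i)_{a,c}\,s_{a+r_i,c},\quad p=\frac{d_i+d_j-m}{q}-1,$$ $$\begin{pmatrix}f_i^{(m+1)}&\varphi_i^{(m+1)}\\ g_j^{(m+1)}&\psi_j^{(m+1)}\end{pmatrix}=U_i^{(m)}\begin{pmatrix}f_i^{(m)}&\varphi_i^{(m)}\\ g_j^{(m)}&\psi_j^{(m)}\end{pmatrix},\qquad U_i^{(m)}=\begin{cases}\begin{pmatrix}1&-\mu_ix^p\\0&1\end{pmatrix}&\text{if }\mu_i=0\text{ or }p\ge 0,\\[2ex]\begin{pmatrix}x^{-p}&-\mu_i\\1/\mu_i&0\end{pmatrix}&\text{otherwise.}\end{cases}$$ Then for every $m\ge 0$ and every $0\le i<q$: 1. $f_i^{(m)}$ is monic and $\rho(f_i^{(m)})\equiv i \pmod q$ (so $r_i$ and $p$ are always integers); 2. $f_i^{(m)},\varphi_i^{(m)}$ solve the $(m-\rho(f_i^{(m)}))$-th approximation of the key equation; 3. $g_i^{(m)},\psi_i^{(m)}$ solve the $(\rho(f_i^{(m)})-q)$-th approximation of the key equation, and $g_i^{(m)}S-\psi_i^{(m)}$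 is monic of order $q^2-1-\rho(f_i^{(m)})$; 4. $\rho(g_i^{(m)})<m-\rho(f_i^{(m)})+q$. -/

import Mathlib

open Polynomial

namespace Hermitian

noncomputable section

/-! ### The Hermitian curve `X^(q+1) = Y^q + Y` -/

/-- The polynomial `Y^q + Y - X^(q+1)`, as a polynomial in `Y` over `F[X]`. -/
def curvePoly (F : Type*) [Field F] (q : ℕ) : F[X][X] :=
  X ^ q + X - C (X ^ (q + 1))

theorem one_lt_q (q : ℕ) [hq : Fact (IsPrimePow q)] : 1 < q := hq.out.one_lt

theorem curvePoly_monic (F : Type*) [Field F] (q : ℕ) [Fact (IsPrimePow q)] :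
    (curvePoly F q).Monic := by
  have hq := one_lt_q q
  have h : (X - C (X ^ (q + 1)) : F[X][X]).degree < (q : WithBot ℕ) := by
    rw [degree_X_sub_C]
    exact_mod_cast hq
  have := monic_X_pow_add (n := q) h
  rwa [← add_sub_assoc] at this

/-- Irreducibility by Eisenstein's criterion at the prime `Y`, with the variables exchanged. -/
theorem curvePoly_irreducible (F : Type*) [Field F] (q : ℕ) [Fact (IsPrimePow q)] :
    Irreducible (curvePoly F q) := by
  have hq := one_lt_q q
  rw [← MulEquiv.irreducible_iff (Bivariate.swap (R := F)).toMulEquiv]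
  have e : (Bivariate.swap (R := F)).toMulEquiv (curvePoly F q) =
      -(X ^ (q + 1) - C (X ^ q + X) : F[X][X]) := by
    change Bivariate.swap (curvePoly F q) = _
    rw [curvePoly, map_sub, map_add, map_pow, Bivariate.swap_Y, C_pow, map_pow,
      Bivariate.swap_X, C_add, C_pow]
    ring
  rw [e]
  refine Associated.irreducible (p := (X ^ (q + 1) - C (X ^ q + X) : F[X][X]))
    ⟨-1, by rw [Units.val_neg, Units.val_one, mul_neg, mul_one]⟩ ?_
  have hm : (X ^ (q + 1) - C (X ^ q + X) : F[X][X]).Monic := monic_X_pow_sub_C _ (by omega)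
  have hp : (Ideal.span {(X : F[X])}).IsPrime :=
    (Ideal.span_singleton_prime X_ne_zero).2 prime_X
  have hd : (X ^ (q + 1) - C (X ^ q + X) : F[X][X]).natDegree = q + 1 := natDegree_X_pow_sub_C
  refine irreducible_of_eisenstein_criterion hp ?_ ?_ ?_ ?_ hm.isPrimitive
  · rw [hm.leadingCoeff]
    exact fun h => hp.ne_top ((Ideal.eq_top_iff_one _).2 h)
  · intro n hn
    rw [degree_eq_natDegree hm.ne_zero, hd] at hn
    have hn' : n < q + 1 := by exact_mod_cast hn
    rw [coeff_sub, coeff_X_pow, if_neg (by omega), coeff_C]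
    split_ifs
    · rw [zero_sub, neg_mem_iff, Ideal.mem_span_singleton]
      exact dvd_add (dvd_pow_self _ (by omega)) dvd_rfl
    · simp
  · rw [degree_eq_natDegree hm.ne_zero, hd]
    exact_mod_cast Nat.succ_pos q
  · rw [coeff_sub, coeff_X_pow, if_neg (by omega), coeff_C, if_pos rfl, zero_sub, neg_mem_iff,
      Ideal.span_singleton_pow, Ideal.mem_span_singleton]
    intro h
    rw [X_pow_dvd_iff] at h
    have := h 1 (by omega)
    rw [coeff_add, coeff_X_pow, coeff_X_one, if_neg (by omega)] at this
    simp at this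

/-- The coordinate ring `F[x,y] = F[X,Y]/(X^(q+1) - Y^q - Y)`. -/
abbrev CoordRing (F : Type*) [Field F] (q : ℕ) : Type _ := AdjoinRoot (curvePoly F q)

instance (F : Type*) [Field F] (q : ℕ) [Fact (IsPrimePow q)] : IsDomain (CoordRing F q) :=
  AdjoinRoot.isDomain_of_prime (curvePoly_irreducible F q).prime

/-- The function field `F(x,y)`. -/
abbrev FunField (F : Type*) [Field F] (q : ℕ) : Type _ := FractionRing (CoordRing F q)

section Defs

variable {F : Type*} [Field F] {q : ℕ}

/-- The class `x` of `X`. -/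
def x : CoordRing F q := AdjoinRoot.of (curvePoly F q) X

/-- The class `y` of `Y`. -/
def y : CoordRing F q := AdjoinRoot.root (curvePoly F q)

variable [Fact (IsPrimePow q)]

/-- `coef f a b` is the coefficient of `x^a y^b` in the expansion of `f` in the monomial basis
`x^a y^b`, `0 ≤ a`, `0 ≤ b < q`, of `F[x,y]` over `F`. -/
def coef (f : CoordRing F q) (a b : ℕ) : F :=
  ((AdjoinRoot.modByMonicHom (curvePoly_monic F q) f).coeff b).coeff a

/-- The finitely many `a` for which `x^a y^b` occurs in `f`. -/
def xSupport (f : CoordRing F q) (b : ℕ) : Finset ℕ :=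
  ((AdjoinRoot.modByMonicHom (curvePoly_monic F q) f).coeff b).support

/-- The order function on `F[x,y]`: the maximum of `aq + b(q+1)` over the monomials `x^a y^b`
that occur in `f`, with `rho 0 = ⊥`. -/
def rho (f : CoordRing F q) : WithBot ℤ :=
  (Finset.range q).sup fun b => (xSupport f b).sup fun a =>
    (((a * q + b * (q + 1) : ℕ) : ℤ) : WithBot ℤ)

/-- The order of a nonzero element of `F[x,y]` as an integer. -/
def ord (f : CoordRing F q) : ℤ := (rho f).unbotD 0

/-- The order function on `F(x,y)`: `rho (f/g) = rho f - rho g`. -/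
def rhoFrac (h : FunField F q) : WithBot ℤ :=
  rho (IsLocalization.sec (nonZeroDivisors (CoordRing F q)) h).1 +
    ((-ord ((IsLocalization.sec (nonZeroDivisors (CoordRing F q)) h).2 : CoordRing F q) : ℤ) :
      WithBot ℤ)

/-! ### The `∗`-basis -/

/-- The `∗`-basis: `z∗_0 = y^(q-1) + 1` and `z∗_b = y^(q-1-b)` for `0 < b < q`. -/
def zstar (b : Fin q) : CoordRing F q :=
  if (b : ℕ) = 0 then y ^ (q - 1) + 1 else y ^ (q - 1 - (b : ℕ))

/-- The order `aq + q² - 1 - b(q+1)` of the term `x^a z∗_b`, `a` an integer. -/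
def termOrder (a : ℤ) (b : Fin q) : ℤ := a * q + ((q : ℤ) ^ 2 - 1 - (b : ℕ) * (q + 1))

/-- The embedding of `F(x)` into `F(x,y)`. -/
def ofRatFunc (h : RatFunc F) : FunField F q :=
  h.eval (algebraMap F (FunField F q)) (algebraMap (CoordRing F q) (FunField F q) x)

/-- The coefficient of `x^a`, `a` an integer, in the expansion of `h ∈ F(x)` as a Laurent series
in `T = 1/x`. -/
def laurentCoeff (h : RatFunc F) (a : ℤ) : F :=
  (h.eval (HahnSeries.C : F →+* LaurentSeries F) (HahnSeries.single (-1 : ℤ) (1 : F))).coeff (-a)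

/-- `c` is the family of coordinates of `h` in the `∗`-basis of `F(x,y)` over `F(x)`. -/
def IsStarExpansion (h : FunField F q) (c : Fin q → RatFunc F) : Prop :=
  h = ∑ b : Fin q, ofRatFunc (c b) * algebraMap (CoordRing F q) (FunField F q) (zstar b)

/-- `h` is monic in the `∗`-basis: the coefficient of its leading term `x^a z∗_b`, the one of
largest order, is `1`. -/
def IsStarMonic (h : FunField F q) : Prop :=
  ∃ c : Fin q → RatFunc F, IsStarExpansion h c ∧
    ∃ (a : ℤ) (b : Fin q), laurentCoeff (c b) a = 1 ∧
      ∀ (a' : ℤ) (b' : Fin q), laurentCoeff (c b') a' ≠ 0 → termOrder a' b' ≤ termOrder a b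

/-- `φ`, written in the `∗`-basis, is a sum of terms of order at least `N`. -/
def StarTermsAtLeast (φ : CoordRing F q) (N : ℤ) : Prop :=
  ∃ c : Fin q → RatFunc F, IsStarExpansion (algebraMap (CoordRing F q) (FunField F q) φ) c ∧
    ∀ (a : ℤ) (b : Fin q), laurentCoeff (c b) a ≠ 0 → N ≤ termOrder a b

/-! ### Approximations of the key equation -/

/-- The element `fS - φ` of `F(x,y)`. -/
def keyDiff (S : FunField F q) (f φ : CoordRing F q) : FunField F q :=
  algebraMap (CoordRing F q) (FunField F q) f * S - algebraMap (CoordRing F q) (FunField F q) φ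

/-- `f, φ` solve the `K`-th approximation of the key equation for `S`. For `f = 0` the solutions
are, by convention, `φ = ± x^(-a-1) z∗_b` with `a < 0` and `K = aq + b(q+1)`. -/
def SolvesKeyEq (S : FunField F q) (K : ℤ) (f φ : CoordRing F q) : Prop :=
  (f ≠ 0 ∧ rhoFrac (keyDiff S f φ) ≤ (((q : ℤ) ^ 2 - q - 1 - K : ℤ) : WithBot ℤ) ∧
      StarTermsAtLeast φ ((q : ℤ) ^ 2 - q - K)) ∨
  (f = 0 ∧ ∃ (a : ℤ) (b : Fin q), a < 0 ∧ K = a * q + (b : ℕ) * (q + 1) ∧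
      (φ = x ^ (-a - 1).toNat * zstar b ∨ φ = -(x ^ (-a - 1).toNat * zstar b)))

end Defs

/-! ### Syndromes -/

/-- The `F`-rational points `(α, β)` of the affine Hermitian curve. -/
def Point (F : Type*) [Field F] (q : ℕ) : Type _ :=
  {P : F × F // P.1 ^ (q + 1) = P.2 ^ q + P.2}

instance (F : Type*) [Field F] [Finite F] (q : ℕ) : Finite (Point F q) :=
  inferInstanceAs (Finite {P : F × F // P.1 ^ (q + 1) = P.2 ^ q + P.2})

instance (F : Type*) [Field F] [Finite F] (q : ℕ) : Fintype (Point F q) := Fintype.ofFinite _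

section Algorithm

variable {F : Type*} [Field F] [Finite F] {q : ℕ}

/-- The syndrome values `s_(a,b) = ∑ e_P α^a β^b` for `a ≥ 0`, and `s_(a,b) = 0` for `a < 0`. -/
def synd (e : Point F q → F) (a : ℤ) (b : ℕ) : F :=
  if 0 ≤ a then ∑ P : Point F q, e P * P.1.1 ^ a.toNat * P.1.2 ^ b else 0

variable [Fact (IsPrimePow q)]

/-- The syndrome `S = ∑ e_P (x^(q+1) - α^(q+1)) / ((x - α)(y - β))` in `F(x,y)`. -/
def syndrome (e : Point F q → F) : FunField F q :=
  ∑ P : Point F q, algebraMap F (FunField F q) (e P) *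
    ((algebraMap (CoordRing F q) (FunField F q) x ^ (q + 1)
        - algebraMap F (FunField F q) P.1.1 ^ (q + 1)) /
      ((algebraMap (CoordRing F q) (FunField F q) x - algebraMap F (FunField F q) P.1.1) *
        (algebraMap (CoordRing F q) (FunField F q) y - algebraMap F (FunField F q) P.1.2)))

/-! ### The decoding algorithm -/

/-- The polynomials `f_i, φ_i, g_i, ψ_i`, `0 ≤ i < q`, that the algorithm maintains. -/
structure State (F : Type*) [Field F] (q : ℕ) where
  f : Fin q → CoordRing F q
  φ : Fin q → CoordRing F q
  g : Fin q → CoordRing F q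
  ψ : Fin q → CoordRing F q

/-- The index `j` with `0 ≤ j < q` and `i + j ≡ m mod q`. -/
def partner (m : ℕ) (i : Fin q) : Fin q :=
  ⟨(m + (q - (i : ℕ))) % q, Nat.mod_lt _ i.pos⟩

/-- `d_i`. -/
def State.d (s : State F q) (i : Fin q) : ℤ := ord (s.f i)

/-- `r_i = (m - d_i - j(q+1)) / q`. -/
def State.r (s : State F q) (m : ℕ) (i : Fin q) : ℤ :=
  ((m : ℤ) - s.d i - (partner m i : ℕ) * (q + 1)) / q

/-- `μ_i = ∑_c ∑_a (y^j f_i)_(a,c) s_(a + r_i, c)`. -/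
def State.μ (e : Point F q → F) (s : State F q) (m : ℕ) (i : Fin q) : F :=
  ∑ c ∈ Finset.range q, ∑ a ∈ xSupport (y ^ (partner m i : ℕ) * s.f i) c,
    coef (y ^ (partner m i : ℕ) * s.f i) a c * synd e ((a : ℤ) + s.r m i) c

/-- `p = (d_i + d_j - m) / q - 1`. -/
def State.p (s : State F q) (m : ℕ) (i : Fin q) : ℤ :=
  (s.d i + s.d (partner m i) - m) / q - 1

open Classical in
/-- The matrix `U_i`. -/
def State.U (e : Point F q → F) (s : State F q) (m : ℕ) (i : Fin q) :
    Matrix (Fin 2) (Fin 2) (CoordRing F q) :=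
  if s.μ e m i = 0 ∨ 0 ≤ s.p m i then
    !![1, -(algebraMap F (CoordRing F q) (s.μ e m i) * x ^ (s.p m i).toNat); 0, 1]
  else
    !![x ^ (-s.p m i).toNat, -algebraMap F (CoordRing F q) (s.μ e m i);
      algebraMap F (CoordRing F q) (s.μ e m i)⁻¹, 0]

/-- The product of `U_i` with the matrix with rows `f_i, φ_i` and `g_j, ψ_j`. -/
def State.B (e : Point F q → F) (s : State F q) (m : ℕ) (i : Fin q) :
    Matrix (Fin 2) (Fin 2) (CoordRing F q) :=
  s.U e m i * !![s.f i, s.φ i; s.g (partner m i), s.ψ (partner m i)]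

/-- Iteration `m`. The first row of `U_i B` is the new `f_i, φ_i` and its second row the new
`g_j, ψ_j`; hence the new `g_i, ψ_i` are the second row for the partner `j` of `i`, whose own
partner is `i`. -/
def State.step (e : Point F q → F) (s : State F q) (m : ℕ) : State F q where
  f i := s.B e m i 0 0
  φ i := s.B e m i 0 1
  g i := s.B e m (partner m i) 1 0
  ψ i := s.B e m (partner m i) 1 1

/-- The data after `m` iterations, with initial value `f_i = y^i`, `φ_i = 0`, `g_i = 0`,
`ψ_i = -z∗_i`. -/
def run (e : Point F q → F) : ℕ → State F q
  | 0 => { f := fun i => y ^ (i : ℕ), φ := fun _ => 0, g := fun _ => 0, ψ := fun i => -zstar i }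
  | m + 1 => (run e m).step e m

end Algorithm

theorem partner_spec {q : ℕ} (m : ℕ) (i : Fin q) : (i : ℕ) + partner m i ≡ m [MOD q] := by
  have hi := i.isLt
  change (i + (m + (q - i)) % q) % q = m % q
  rw [Nat.add_mod_mod, show (i : ℕ) + (m + (q - i)) = m + q by omega, Nat.add_mod_right]

theorem partner_partner {q : ℕ} (m : ℕ) (i : Fin q) : partner m (partner m i) = i := by
  have h : (partner m (partner m i) : ℕ) ≡ i [MOD q] := by
    refine Nat.ModEq.add_left_cancel' (partner m i : ℕ) ?_
    exact (partner_spec m (partner m i)).trans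
      ((partner_spec m i).symm.trans (by rw [Nat.add_comm]))
  exact Fin.ext (h.eq_of_lt_of_lt (Fin.isLt _) i.isLt)

end

end Hermitian

/-!
With `t = x / y` as local parameter at the unique point at infinity, `x` and `y` have poles of order
`q` and `q + 1`, and the monomials `x^a y^b` with `b < q` have pairwise distinct pole orders.
So `ρ` is the pole order, "monic" means that the leading coefficient of the expansion in `t` is `1`,
and the same holds for the terms `x^a z∗_b`.

The coordinate of an element of `F(x,y)` at `z∗_0` is an `F(x)`-linear form for which `(z∗_b)` is
dual to `(y^b)`, and it maps `F[x,y]` to `F[x]`. Multiplying `f_i S - φ_i` by `y^j` moves its term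
of the relevant order to `z∗_0`, where `φ_i` does not contribute, and this identifies `μ_i` as the
coefficient of `f_i S - φ_i` in the first order at which the approximation may fail. Likewise
`f_j (f_i S - φ_i) - f_i (f_j S - φ_j)` lies in `F[x,y]`, so it has no term `x^p z∗_0` with `p < 0`,
and therefore `μ_i = μ_j` if `p < 0`. Hence `U_i` and `U_j` are of the same type, and the new row
`f_i, φ_i` cancels the coefficient `μ_i` against the monic `g_j S - ψ_j`.
-/

namespace Hermitian

noncomputable section

/-! ### Leading terms of Hahn series -/

/-- `h = a T^n + (terms of higher order)`. The coefficient `a` may vanish, so that `LeadAt h n a`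
for some `a` says that `h` has order at least `n`, and `LeadAt h n 0` that it has larger order. -/
def LeadAt {Γ R : Type*} [PartialOrder Γ] [Zero R] (h : HahnSeries Γ R) (n : Γ) (a : R) : Prop :=
  h.coeff n = a ∧ ∀ k < n, h.coeff k = 0

namespace LeadAt

section Basic

variable {Γ R : Type*} [PartialOrder Γ] [Zero R] {h : HahnSeries Γ R} {n n' : Γ} {a a' : R}

theorem unique (ha : LeadAt h n a) (ha' : LeadAt h n a') : a = a' := ha.1.symm.trans ha'.1

theorem zero (n : Γ) : LeadAt (0 : HahnSeries Γ R) n 0 := ⟨rfl, fun _ _ => rfl⟩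

theorem single (n : Γ) (a : R) : LeadAt (HahnSeries.single n a) n a :=
  ⟨HahnSeries.coeff_single_same _ _, fun _ hk => HahnSeries.coeff_single_of_ne hk.ne⟩

theorem of_lt (hl : LeadAt h n a) (hn : n' < n) : LeadAt h n' 0 :=
  ⟨hl.2 _ hn, fun k hk => hl.2 k (hk.trans hn)⟩

theorem ne_zero (hl : LeadAt h n a) (ha : a ≠ 0) : h ≠ 0 := by
  rintro rfl
  exact ha (hl.unique (zero n))

theorem exists_add_one {h : HahnSeries ℤ R} {n : ℤ} (hl : LeadAt h n 0) :
    ∃ α, LeadAt h (n + 1) α := by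
  refine ⟨_, rfl, fun k hk => ?_⟩
  rcases (Int.lt_add_one_iff.1 hk).eq_or_lt with rfl | hk
  exacts [hl.1, hl.2 k hk]

end Basic

section LinearOrder

variable {Γ R : Type*} [LinearOrder Γ] [Zero R] {h : HahnSeries Γ R} {n n' : Γ} {a a' : R}

theorem le_of_ne_zero (hl : LeadAt h n a) (hl' : LeadAt h n' a') (ha' : a' ≠ 0) : n ≤ n' := by
  by_contra! hn
  exact ha' (hl'.unique (hl.of_lt hn))

theorem eq_of_ne_zero (hl : LeadAt h n a) (ha : a ≠ 0) (hl' : LeadAt h n' a') (ha' : a' ≠ 0) :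
    n = n' :=
  (hl.le_of_ne_zero hl' ha').antisymm (hl'.le_of_ne_zero hl ha)

theorem exists_of_ne_zero (hh : h ≠ 0) : ∃ (n : Γ) (a : R), a ≠ 0 ∧ LeadAt h n a := by
  have htop := HahnSeries.orderTop_ne_top.2 hh
  refine ⟨h.orderTop.untop htop, h.leadingCoeff, HahnSeries.leadingCoeff_ne_zero.2 hh,
    HahnSeries.coeff_untop_eq_leadingCoeff htop, fun _ hk => ?_⟩
  exact HahnSeries.coeff_eq_zero_of_lt_orderTop ((WithTop.lt_untop_iff htop).1 hk)

end LinearOrder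

section Add

variable {Γ R : Type*} [PartialOrder Γ] {n : Γ}

theorem add [AddMonoid R] {h h' : HahnSeries Γ R} {a a' : R} (hl : LeadAt h n a)
    (hl' : LeadAt h' n a') : LeadAt (h + h') n (a + a') :=
  ⟨by rw [HahnSeries.coeff_add, hl.1, hl'.1],
    fun k hk => by rw [HahnSeries.coeff_add, hl.2 k hk, hl'.2 k hk, add_zero]⟩

theorem sub [AddGroup R] {h h' : HahnSeries Γ R} {a a' : R} (hl : LeadAt h n a)
    (hl' : LeadAt h' n a') : LeadAt (h - h') n (a - a') :=
  ⟨by rw [HahnSeries.coeff_sub, hl.1, hl'.1],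
    fun k hk => by rw [HahnSeries.coeff_sub, hl.2 k hk, hl'.2 k hk, sub_zero]⟩

theorem sum [AddCommMonoid R] {ι : Type*} {s : Finset ι} {u : ι → HahnSeries Γ R} {a : ι → R}
    (hu : ∀ b ∈ s, LeadAt (u b) n (a b)) : LeadAt (∑ b ∈ s, u b) n (∑ b ∈ s, a b) :=
  ⟨by rw [HahnSeries.coeff_sum]; exact Finset.sum_congr rfl fun b hb => (hu b hb).1,
    fun k hk => by rw [HahnSeries.coeff_sum]; exact Finset.sum_eq_zero fun b hb => (hu b hb).2 k hk⟩

theorem sum_of_dominant [AddCommMonoid R] {ι : Type*} {s : Finset ι} {u : ι → HahnSeries Γ R}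
    {b : ι} {a : R} (hb : b ∈ s) (hub : LeadAt (u b) n a)
    (hu : ∀ c ∈ s, c ≠ b → LeadAt (u c) n 0) : LeadAt (∑ c ∈ s, u c) n a := by
  classical
  rw [← Finset.sum_ite_eq_of_mem' s b (fun _ => a) hb]
  refine sum fun c hc => ?_
  split_ifs with hcb
  exacts [hcb ▸ hub, hu c hc hcb]

end Add

section Mul

variable {Γ R : Type*} [AddCommMonoid Γ] [LinearOrder Γ] [IsOrderedCancelAddMonoid Γ] [Semiring R]
  {h h' : HahnSeries Γ R} {n n' : Γ} {a a' : R}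

theorem const (a : R) : LeadAt (HahnSeries.C a : HahnSeries Γ R) 0 a := single 0 a

theorem one : LeadAt (1 : HahnSeries Γ R) 0 1 := const 1

theorem mul (hl : LeadAt h n a) (hl' : LeadAt h' n' a') : LeadAt (h * h') (n + n') (a * a') := by
  have coeff_eq_zero {i j : Γ} (hij : i < n ∨ j < n') : h.coeff i * h'.coeff j = 0 := by
    rcases hij with hi | hj
    · rw [hl.2 i hi, zero_mul]
    · rw [hl'.2 j hj, mul_zero]
  refine ⟨?_, fun k hk => ?_⟩
  · rw [HahnSeries.coeff_mul, ← hl.1, ← hl'.1]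
    refine Finset.sum_eq_single (n, n') (fun ij hij hne => coeff_eq_zero ?_) fun hmem => ?_
    · by_contra! hle
      have heq := (add_eq_add_iff_eq_and_eq hle.1 hle.2).1 (Finset.mem_antidiagonal.1 hij).2.2.symm
      exact hne (Prod.ext heq.1.symm heq.2.symm)
    · by_contra hne
      exact hmem (Finset.mem_antidiagonal.2
        ⟨left_ne_zero_of_mul hne, right_ne_zero_of_mul hne, rfl⟩)
  · rw [HahnSeries.coeff_mul]
    refine Finset.sum_eq_zero fun ij hij => coeff_eq_zero ?_
    by_contra! hle
    exact (add_le_add hle.1 hle.2).not_gt ((Finset.mem_antidiagonal.1 hij).2.2 ▸ hk)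

theorem pow (hl : LeadAt h n a) (k : ℕ) : LeadAt (h ^ k) (k • n) (a ^ k) := by
  induction k with
  | zero => simpa only [pow_zero, zero_smul] using one
  | succ k ih =>
    rw [pow_succ, pow_succ, succ_nsmul]
    exact ih.mul hl

end Mul

section Inv

variable {Γ K : Type*} [AddCommGroup Γ] [LinearOrder Γ] [IsOrderedAddMonoid Γ] [Field K]
  {h h' : HahnSeries Γ K} {n n' : Γ} {a a' : K}

theorem inv (hl : LeadAt h n a) (ha : a ≠ 0) : LeadAt h⁻¹ (-n) a⁻¹ := by
  have hh := hl.ne_zero ha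
  obtain ⟨k, b, hb, hl'⟩ := exists_of_ne_zero (inv_ne_zero hh)
  have hmul := hl.mul hl'
  rw [mul_inv_cancel₀ hh] at hmul
  have hk : n + k = 0 := hmul.eq_of_ne_zero (mul_ne_zero ha hb) one one_ne_zero
  rw [hk] at hmul
  rwa [neg_eq_of_add_eq_zero_right hk, inv_eq_of_mul_eq_one_right (hmul.unique one)]

theorem div (hl : LeadAt h n a) (hl' : LeadAt h' n' a') (ha' : a' ≠ 0) :
    LeadAt (h / h') (n - n') (a / a') := by
  rw [div_eq_mul_inv, div_eq_mul_inv, sub_eq_add_neg]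
  exact hl.mul (hl'.inv ha')

end Inv

theorem ofPowerSeries {R : Type*} [Semiring R] (P : PowerSeries R) :
    LeadAt (HahnSeries.ofPowerSeries ℤ R P) 0 (PowerSeries.constantCoeff P) :=
  ⟨by simpa using HahnSeries.ofPowerSeries_apply_coeff (Γ := ℤ) P 0, fun k hk => by
    rw [PowerSeries.coeff_coe, if_pos hk]⟩

section Eval

theorem eval₂ {R : Type*} [CommSemiring R] {ξ : LaurentSeries R} {k : ℤ} (hξ : LeadAt ξ (-k) 1)
    (hk : 0 < k) (p : R[X]) :
    LeadAt (p.eval₂ HahnSeries.C ξ) (-(k * p.natDegree)) p.leadingCoeff := by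
  have leadAt_term (j : ℕ) : LeadAt (HahnSeries.C (p.coeff j) * ξ ^ j) (-(k * j)) (p.coeff j) := by
    have := (const (p.coeff j)).mul (hξ.pow j)
    rwa [one_pow, mul_one, zero_add, nsmul_eq_mul, mul_neg, mul_comm (j : ℤ)] at this
  rw [eval₂_eq_sum_range]
  refine sum_of_dominant (Finset.self_mem_range_succ _) (leadAt_term _) fun j hj hne => ?_
  refine (leadAt_term j).of_lt (neg_lt_neg (mul_lt_mul_of_pos_left ?_ hk))
  exact_mod_cast (Finset.mem_range_succ_iff.1 hj).lt_of_ne hne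

variable {K : Type*} [Field K] {ξ : LaurentSeries K} {k : ℤ}

theorem eval₂RingHom_injective (hξ : LeadAt ξ (-k) 1) (hk : 0 < k) :
    Function.Injective (eval₂RingHom (HahnSeries.C : K →+* LaurentSeries K) ξ) := by
  rw [injective_iff_map_eq_zero]
  intro p hp
  by_contra h
  exact (hξ.eval₂ hk p).ne_zero (leadingCoeff_ne_zero.2 h) hp

theorem ratFuncEval (hξ : LeadAt ξ (-k) 1) (hk : 0 < k) (c : RatFunc K) :
    LeadAt (c.eval HahnSeries.C ξ) (-(k * c.intDegree)) c.num.leadingCoeff := by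
  have hden := hξ.eval₂ hk c.denom
  rw [c.monic_denom] at hden
  have := (hξ.eval₂ hk c.num).div hden one_ne_zero
  rw [div_one] at this
  rw [RatFunc.eval, RatFunc.intDegree]
  convert this using 1
  ring

end Eval

end LeadAt

/-! ### Rational functions as Laurent series in `1 / x` -/

/-- Evaluation of rational functions at an element `a` that is transcendental over `K`, as a ring
homomorphism. -/
def ratFuncEvalHom.{u} {K L : Type u} [Field K] [Field L] (f : K →+* L) (a : L)
    (ha : Function.Injective (eval₂RingHom f a)) : RatFunc K →+* L :=
  RatFunc.liftRingHom (eval₂RingHom f a)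
    (nonZeroDivisors_le_comap_nonZeroDivisors_of_injective _ ha)

theorem ratFuncEvalHom_apply.{u} {K L : Type u} [Field K] [Field L] (f : K →+* L) (a : L)
    (ha : Function.Injective (eval₂RingHom f a)) (c : RatFunc K) :
    ratFuncEvalHom f a ha c = c.eval f a := by
  conv_lhs => rw [← RatFunc.num_div_denom c]
  rw [ratFuncEvalHom, RatFunc.liftRingHom_apply_div]
  rfl

theorem ratFunc_algebraMap_eq_sum {K : Type*} [Field K] (p : K[X]) :
    algebraMap K[X] (RatFunc K) p = ∑ a ∈ p.support, RatFunc.C (p.coeff a) * RatFunc.X ^ a := by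
  conv_lhs => rw [p.as_sum_support_C_mul_X_pow]
  simp only [map_sum, map_mul, map_pow, RatFunc.algebraMap_C, RatFunc.algebraMap_X]

section LaurentCoeff

variable {F : Type*} [Field F]

variable (F) in
/-- The expansion of rational functions in `x` as Laurent series in `1 / x`. -/
def laurentHom : RatFunc F →+* LaurentSeries F :=
  ratFuncEvalHom HahnSeries.C (HahnSeries.single (-1 : ℤ) (1 : F))
    (LeadAt.eval₂RingHom_injective (LeadAt.single _ _) one_pos)

theorem laurentHom_apply (c : RatFunc F) :
    laurentHom F c = c.eval HahnSeries.C (HahnSeries.single (-1 : ℤ) (1 : F)) :=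
  ratFuncEvalHom_apply _ _ _ c

theorem laurentHom_C (a : F) : laurentHom F (RatFunc.C a) = HahnSeries.C a := by
  rw [laurentHom_apply, RatFunc.eval_C]

theorem laurentHom_X : laurentHom F RatFunc.X = HahnSeries.single (-1 : ℤ) (1 : F) := by
  rw [laurentHom_apply, RatFunc.eval_X]

theorem laurentCoeff_eq (c : RatFunc F) (a : ℤ) :
    laurentCoeff c a = (laurentHom F c).coeff (-a) := by
  rw [laurentHom_apply, laurentCoeff]

theorem leadAt_laurentHom (c : RatFunc F) :
    LeadAt (laurentHom F c) (-c.intDegree) c.num.leadingCoeff := by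
  have := (LeadAt.single (-1 : ℤ) (1 : F)).ratFuncEval one_pos c
  rwa [one_mul, ← laurentHom_apply] at this

theorem laurentCoeff_intDegree (c : RatFunc F) :
    laurentCoeff c c.intDegree = c.num.leadingCoeff := by
  rw [laurentCoeff_eq, (leadAt_laurentHom c).1]

theorem laurentCoeff_of_intDegree_lt {c : RatFunc F} {a : ℤ} (ha : c.intDegree < a) :
    laurentCoeff c a = 0 := by
  rw [laurentCoeff_eq, (leadAt_laurentHom c).2 _ (neg_lt_neg ha)]

theorem laurentCoeff_zero (a : ℤ) : laurentCoeff (0 : RatFunc F) a = 0 := by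
  rw [laurentCoeff_eq, map_zero, HahnSeries.coeff_zero]

theorem laurentCoeff_one (a : ℤ) : laurentCoeff (1 : RatFunc F) a = if a = 0 then 1 else 0 := by
  rw [laurentCoeff_eq, map_one, HahnSeries.coeff_one]
  simp only [neg_eq_zero]

theorem laurentCoeff_add (c c' : RatFunc F) (a : ℤ) :
    laurentCoeff (c + c') a = laurentCoeff c a + laurentCoeff c' a := by
  simp only [laurentCoeff_eq, map_add, HahnSeries.coeff_add]

theorem laurentCoeff_sub (c c' : RatFunc F) (a : ℤ) :
    laurentCoeff (c - c') a = laurentCoeff c a - laurentCoeff c' a := by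
  simp only [laurentCoeff_eq, map_sub, HahnSeries.coeff_sub]

theorem laurentCoeff_sum {τ : Type*} (s : Finset τ) (c : τ → RatFunc F) (a : ℤ) :
    laurentCoeff (∑ t ∈ s, c t) a = ∑ t ∈ s, laurentCoeff (c t) a := by
  simp only [laurentCoeff_eq, map_sum, HahnSeries.coeff_sum]

theorem laurentCoeff_C_mul (r : F) (c : RatFunc F) (a : ℤ) :
    laurentCoeff (RatFunc.C r * c) a = r * laurentCoeff c a := by
  rw [laurentCoeff_eq, laurentCoeff_eq, map_mul, laurentHom_C, HahnSeries.C_apply,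
    HahnSeries.coeff_single_zero_mul]

theorem laurentCoeff_X_pow_mul (k : ℕ) (c : RatFunc F) (a : ℤ) :
    laurentCoeff (RatFunc.X ^ k * c) a = laurentCoeff c (a - k) := by
  rw [laurentCoeff_eq, laurentCoeff_eq, map_mul, map_pow, laurentHom_X, HahnSeries.single_pow,
    HahnSeries.coeff_single_mul, one_pow, one_mul]
  congr 1
  rw [nsmul_eq_mul]
  ring

theorem laurentCoeff_algebraMap_mul (p : F[X]) (c : RatFunc F) (n : ℤ) :
    laurentCoeff (algebraMap F[X] (RatFunc F) p * c) n =
      ∑ a ∈ p.support, p.coeff a * laurentCoeff c (n - a) := by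
  simp only [ratFunc_algebraMap_eq_sum p, Finset.sum_mul, laurentCoeff_sum, mul_assoc,
    laurentCoeff_C_mul, laurentCoeff_X_pow_mul]

theorem laurentCoeff_algebraMap_of_neg (p : F[X]) {n : ℤ} (hn : n < 0) :
    laurentCoeff (algebraMap F[X] (RatFunc F) p) n = 0 := by
  rw [← mul_one (algebraMap F[X] (RatFunc F) p), laurentCoeff_algebraMap_mul]
  refine Finset.sum_eq_zero fun a _ => ?_
  rw [laurentCoeff_one, if_neg (by omega), mul_zero]

theorem laurentCoeff_inv_X_sub_C (α : F) (k : ℤ) :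
    laurentCoeff (RatFunc.X - RatFunc.C α)⁻¹ (-1 - k) = if 0 ≤ k then α ^ k.toNat else 0 := by
  set u : RatFunc F := (RatFunc.X - RatFunc.C α)⁻¹ with hu
  have hlead : LeadAt (HahnSeries.single (-1 : ℤ) (1 : F) - HahnSeries.C α) (-1) 1 := by
    simpa only [sub_zero] using
      (LeadAt.single (-1) (1 : F)).sub ((LeadAt.const α).of_lt (neg_lt_zero.2 one_pos))
  have hXα : RatFunc.X - RatFunc.C α ≠ 0 := fun h => by
    have := congrArg (laurentHom F) h
    rw [map_sub, laurentHom_X, laurentHom_C, map_zero] at this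
    exact hlead.ne_zero one_ne_zero this
  have coeff_eq_zero {n : ℤ} (hn : -1 < n) : laurentCoeff u n = 0 := by
    rw [laurentCoeff_eq, hu, map_inv₀, map_sub, laurentHom_X, laurentHom_C]
    exact (hlead.inv one_ne_zero).2 _ (neg_lt_neg hn)
  have coeff_rec (n : ℤ) :
      laurentCoeff u (n - 1) = α * laurentCoeff u n + if n = 0 then 1 else 0 := by
    rw [← laurentCoeff_one, ← mul_inv_cancel₀ hXα, ← hu, sub_mul, laurentCoeff_sub,
      laurentCoeff_C_mul, add_sub_cancel, ← pow_one RatFunc.X, laurentCoeff_X_pow_mul, Nat.cast_one]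
  split_ifs with hk
  · lift k to ℕ using hk
    rw [Int.toNat_natCast]
    induction k with
    | zero => simpa [coeff_eq_zero] using coeff_rec 0
    | succ k ih =>
      have := coeff_rec (-1 - k)
      rwa [ih, if_neg (by omega), add_zero, ← pow_succ', sub_sub] at this
  · exact coeff_eq_zero (by omega)

end LaurentCoeff

/-! ### The Hermitian curve at the point at infinity -/

theorem exists_pow_add_self_eq {R : Type*} [CommRing R] {I : Ideal R} [HenselianRing R I] {n : ℕ}
    (hn : 1 < n) {r : R} (hr : r ∈ I) : ∃ w ∈ I, w ^ n + w = r := by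
  have hdeg : (X - C r : R[X]).degree < n := (degree_X_sub_C_le r).trans_lt (by exact_mod_cast hn)
  have heval : eval 0 (X ^ n + (X - C r)) ∈ I := by
    simpa [(zero_lt_one.trans hn).ne'] using hr
  have hderiv : eval 0 (derivative (X ^ n + (X - C r))) = 1 := by
    simp [derivative_X_pow, (Nat.sub_pos_of_lt hn).ne']
  obtain ⟨w, hroot, hw⟩ := HenselianRing.is_henselian _ (monic_X_pow_add hdeg) 0 heval
    (by rw [hderiv, map_one]; exact isUnit_one)
  refine ⟨w, by rwa [sub_zero] at hw, ?_⟩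
  rw [IsRoot, eval_add, eval_pow, eval_sub, eval_X, eval_C] at hroot
  linear_combination hroot

section Expansion

variable (F : Type*) [Field F] (q : ℕ) [Fact (IsPrimePow q)]

theorem exists_yInvSeries : ∃ w : LaurentSeries F,
    w ^ q + w = HahnSeries.single (1 : ℤ) 1 ^ (q + 1) ∧ LeadAt w (q + 1) 1 := by
  have hq := one_lt_q q
  obtain ⟨w, hw, hwq⟩ := exists_pow_add_self_eq hq
    (Ideal.mem_span_singleton.2 (dvd_pow_self (PowerSeries.X : PowerSeries F) q.succ_ne_zero))
  have hcoe : (w : LaurentSeries F) ^ q + (w : LaurentSeries F) =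
      HahnSeries.single (1 : ℤ) 1 ^ (q + 1) := by
    rw [← map_pow, ← map_add, hwq, map_pow, HahnSeries.ofPowerSeries_X]
  refine ⟨w, hcoe, ?_⟩
  have hunit : LeadAt ((w : LaurentSeries F) ^ (q - 1) + 1) 0 1 := by
    have := LeadAt.ofPowerSeries (w ^ (q - 1) + 1)
    rw [Ideal.mem_span_singleton, PowerSeries.X_dvd_iff] at hw
    rwa [map_add, map_pow, map_one, map_add, map_pow, map_one, hw,
      zero_pow (Nat.sub_pos_of_lt hq).ne', zero_add] at this
  have hfactor : (w : LaurentSeries F) * ((w : LaurentSeries F) ^ (q - 1) + 1) =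
      HahnSeries.single (1 : ℤ) 1 ^ (q + 1) := by
    rw [← hcoe, mul_add, mul_one, ← pow_succ', Nat.sub_add_cancel hq.le]
  have := ((LeadAt.single (1 : ℤ) (1 : F)).pow (q + 1)).div hunit one_ne_zero
  rw [← hfactor, mul_div_cancel_right₀ _ (hunit.ne_zero one_ne_zero)] at this
  simpa using this

/-- The expansion of `1 / y` in the local parameter `t = x / y` at the point at infinity. It is
determined by `w ^ q + w = t ^ (q + 1)`, which is the equation of the curve divided by
`y ^ (q + 1)`. -/
def yInvSeries : LaurentSeries F := (exists_yInvSeries F q).choose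

/-- The expansion of `y` in the local parameter `x / y` at the point at infinity. -/
def ySeries : LaurentSeries F := (yInvSeries F q)⁻¹

/-- The expansion of `x` in the local parameter `x / y` at the point at infinity. -/
def xSeries : LaurentSeries F := HahnSeries.single 1 1 * ySeries F q

theorem leadAt_yInvSeries : LeadAt (yInvSeries F q) (q + 1) 1 :=
  (exists_yInvSeries F q).choose_spec.2

theorem leadAt_ySeries : LeadAt (ySeries F q) (-(q + 1)) 1 := by
  have := (leadAt_yInvSeries F q).inv one_ne_zero
  rwa [inv_one] at this

theorem leadAt_xSeries : LeadAt (xSeries F q) (-q) 1 := by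
  have := (LeadAt.single 1 (1 : F)).mul (leadAt_ySeries F q)
  rwa [one_mul, neg_add_rev, ← add_assoc, add_neg_cancel, zero_add] at this

theorem xSeries_pow : xSeries F q ^ (q + 1) = ySeries F q ^ q + ySeries F q := by
  have hw : yInvSeries F q ≠ 0 := (leadAt_yInvSeries F q).ne_zero one_ne_zero
  rw [xSeries, ySeries, mul_pow, inv_pow, inv_pow,
    ← (exists_yInvSeries F q).choose_spec.1, ← yInvSeries]
  field_simp
  ring

/-- The ring homomorphism that expands the elements of `F[x,y]` as Laurent series in the local
parameter `x / y` at the point at infinity. -/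
def expandRing : CoordRing F q →+* LaurentSeries F :=
  AdjoinRoot.lift (eval₂RingHom HahnSeries.C (xSeries F q)) (ySeries F q) (by
    rw [curvePoly, eval₂_sub, eval₂_add, eval₂_X_pow, eval₂_X, eval₂_C, coe_eval₂RingHom,
      eval₂_X_pow, xSeries_pow, sub_self])

theorem expandRing_x : expandRing F q x = xSeries F q := by
  rw [x, expandRing, AdjoinRoot.lift_of, coe_eval₂RingHom, eval₂_X]

theorem expandRing_y : expandRing F q y = ySeries F q := by
  rw [y, expandRing, AdjoinRoot.lift_root]

theorem expandRing_algebraMap (a : F) :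
    expandRing F q (algebraMap F (CoordRing F q) a) = HahnSeries.C a := by
  rw [IsScalarTower.algebraMap_apply F F[X] (CoordRing F q), AdjoinRoot.algebraMap_eq, expandRing,
    AdjoinRoot.lift_of, coe_eval₂RingHom, algebraMap_eq, eval₂_C]

end Expansion

section Order

theorem weight_injective {q b b' : ℕ} (hb : b < q) (hb' : b' < q) {a a' : ℤ}
    (h : a * q + b * (q + 1) = a' * q + b' * (q + 1)) : a = a' ∧ b = b' := by
  have hmod : (b' : ℤ) ≡ b [ZMOD q] :=
    Int.modEq_iff_dvd.2 ⟨a' - a + b' - b, by linear_combination h⟩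
  have hbb' : b = b' := ((Int.natCast_modEq_iff.1 hmod).eq_of_lt_of_lt hb' hb).symm
  subst hbb'
  have hq : (q : ℤ) ≠ 0 := by omega
  exact ⟨mul_right_cancel₀ hq (add_right_cancel h), rfl⟩

variable {F : Type*} [Field F] {q : ℕ}

theorem of_eq_sum (p : F[X]) : AdjoinRoot.of (curvePoly F q) p =
    ∑ a ∈ p.support, algebraMap F (CoordRing F q) (p.coeff a) * x ^ a := by
  conv_lhs => rw [p.as_sum_support_C_mul_X_pow]
  simp only [map_sum, map_mul, map_pow]
  rfl

variable [Fact (IsPrimePow q)]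

theorem natDegree_curvePoly : (curvePoly F q).natDegree = q := by
  rw [curvePoly, add_sub_assoc, natDegree_add_eq_left_of_natDegree_lt, natDegree_X_pow]
  rw [natDegree_X_sub_C, natDegree_X_pow]
  exact one_lt_q q

/-- The coordinate of `f` at `y^b` in the basis `1, y, …, y^(q-1)` of `F[x,y]` over `F[x]`. -/
def yCoeff (f : CoordRing F q) (b : ℕ) : F[X] :=
  (AdjoinRoot.modByMonicHom (curvePoly_monic F q) f).coeff b

theorem eq_sum_yCoeff (f : CoordRing F q) :
    f = ∑ b ∈ Finset.range q, AdjoinRoot.of (curvePoly F q) (yCoeff f b) * y ^ b := by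
  have hone : curvePoly F q ≠ 1 := fun h => by
    have := congrArg natDegree h
    rw [natDegree_curvePoly, natDegree_one] at this
    exact absurd (one_lt_q q) (by omega)
  have hdeg : (AdjoinRoot.modByMonicHom (curvePoly_monic F q) f).natDegree < q := by
    obtain ⟨p, rfl⟩ := AdjoinRoot.mk_surjective f
    rw [AdjoinRoot.modByMonicHom_mk]
    exact (natDegree_modByMonic_lt p (curvePoly_monic F q) hone).trans_eq natDegree_curvePoly
  have hmk : AdjoinRoot.mk (curvePoly F q) (AdjoinRoot.modByMonicHom (curvePoly_monic F q) f) = f :=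
    AdjoinRoot.mk_leftInverse (curvePoly_monic F q) f
  have hsum := congrArg (AdjoinRoot.mk (curvePoly F q)) (as_sum_range' _ q hdeg)
  rw [hmk, map_sum] at hsum
  refine hsum.trans (Finset.sum_congr rfl fun b _ => ?_)
  rw [← C_mul_X_pow_eq_monomial, map_mul, map_pow, AdjoinRoot.mk_C, AdjoinRoot.mk_X]
  rfl

theorem eq_sum_monomials (f : CoordRing F q) :
    f = ∑ t ∈ (Finset.range q).sigma (xSupport f),
      algebraMap F (CoordRing F q) (coef f t.2 t.1) * x ^ t.2 * y ^ t.1 := by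
  conv_lhs => rw [eq_sum_yCoeff f]
  rw [Finset.sum_sigma]
  refine Finset.sum_congr rfl fun b _ => ?_
  rw [of_eq_sum, Finset.sum_mul]
  rfl

theorem leadAt_expandRing_monomial (c : F) (a b : ℕ) :
    LeadAt (expandRing F q (algebraMap F (CoordRing F q) c * x ^ a * y ^ b))
      (-(a * q + b * (q + 1))) c := by
  have := ((LeadAt.const c).mul ((leadAt_xSeries F q).pow a)).mul ((leadAt_ySeries F q).pow b)
  rw [one_pow, one_pow, mul_one, mul_one, nsmul_eq_mul, nsmul_eq_mul] at this
  rw [map_mul, map_mul, map_pow, map_pow, expandRing_algebraMap, expandRing_x, expandRing_y]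
  convert this using 1
  ring

theorem rho_eq_sup (f : CoordRing F q) : rho f = ((Finset.range q).sigma (xSupport f)).sup
    fun t => (((t.2 * q + t.1 * (q + 1) : ℕ) : ℤ) : WithBot ℤ) := by
  rw [Finset.sup_sigma]
  rfl

theorem exists_leadAt_expandRing {f : CoordRing F q} (hf : f ≠ 0) :
    ∃ (N : ℤ) (a : F), a ≠ 0 ∧ rho f = N ∧ LeadAt (expandRing F q f) (-N) a := by
  let s := (Finset.range q).sigma (xSupport f)
  let weight (t : (_ : ℕ) × ℕ) : ℤ := (t.2 * q + t.1 * (q + 1) : ℕ)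
  have hs : s.Nonempty := by
    rw [Finset.nonempty_iff_ne_empty]
    intro h
    rw [eq_sum_monomials f, show (Finset.range q).sigma (xSupport f) = ∅ from h,
      Finset.sum_empty] at hf
    exact hf rfl
  obtain ⟨t, ht, hmax⟩ := s.exists_max_image weight hs
  refine ⟨weight t, coef f t.2 t.1, mem_support_iff.1 (Finset.mem_sigma.1 ht).2, ?_, ?_⟩
  · rw [rho_eq_sup]
    exact (Finset.sup_le fun t' ht' => WithBot.coe_le_coe.2 (hmax t' ht')).antisymm
      (Finset.le_sup (f := fun t => (weight t : WithBot ℤ)) ht)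
  have hlead (t' : (_ : ℕ) × ℕ) : LeadAt
      (expandRing F q (algebraMap F (CoordRing F q) (coef f t'.2 t'.1) * x ^ t'.2 * y ^ t'.1))
      (-weight t') (coef f t'.2 t'.1) := by
    simpa only [weight, Nat.cast_add, Nat.cast_mul, Nat.cast_one] using
      leadAt_expandRing_monomial (coef f t'.2 t'.1) t'.2 t'.1
  have hf_eq := congrArg (expandRing F q) (eq_sum_monomials f)
  rw [map_sum] at hf_eq
  rw [hf_eq]
  refine LeadAt.sum_of_dominant ht (hlead t) fun t' ht' hne => (hlead t').of_lt ?_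
  refine neg_lt_neg ((hmax t' ht').lt_of_ne fun h => hne ?_)
  obtain ⟨ha, hb⟩ := weight_injective (Finset.mem_range.1 (Finset.mem_sigma.1 ht').1)
    (Finset.mem_range.1 (Finset.mem_sigma.1 ht).1) (a := t'.2) (a' := t.2)
    (by simpa [weight] using h)
  exact Sigma.ext hb (heq_of_eq (Int.natCast_inj.1 ha))

theorem rho_zero : rho (0 : CoordRing F q) = ⊥ := by
  rw [rho]
  refine Finset.sup_eq_bot_iff _ _ |>.2 fun b _ => ?_
  rw [xSupport, map_zero, coeff_zero, support_zero, Finset.sup_empty]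

theorem expandRing_injective : Function.Injective (expandRing F q) := by
  rw [injective_iff_map_eq_zero]
  intro f hf
  by_contra h
  obtain ⟨N, a, ha, -, hl⟩ := exists_leadAt_expandRing h
  exact hl.ne_zero ha hf

variable (F q) in
/-- The ring homomorphism that expands the elements of `F(x,y)` as Laurent series in the local
parameter `x / y` at the point at infinity. -/
def expand : FunField F q →+* LaurentSeries F :=
  IsFractionRing.lift (expandRing_injective (F := F) (q := q))

theorem expand_algebraMap (f : CoordRing F q) :
    expand F q (algebraMap (CoordRing F q) (FunField F q) f) = expandRing F q f :=
  IsFractionRing.lift_algebraMap _ _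

end Order

section FunctionField

variable {F : Type*} [Field F] {q : ℕ} [Fact (IsPrimePow q)]

local notation "ι" => algebraMap (CoordRing F q) (FunField F q)

/-- `h` has a pole of order at most `N` at the point at infinity, and `α`, which may vanish, is the
coefficient of order `N` of `h`. Orders are counted as by `rho`, positively for poles. -/
def HasLead (h : FunField F q) (N : ℤ) (α : F) : Prop :=
  LeadAt (expand F q h) (-N) α

namespace HasLead

variable {h h' : FunField F q} {N N' : ℤ} {α α' : F}

theorem unique (hl : HasLead h N α) (hl' : HasLead h N α') : α = α' := LeadAt.unique hl hl'

theorem ne_zero (hl : HasLead h N α) (hα : α ≠ 0) : h ≠ 0 := by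
  rintro rfl
  exact LeadAt.ne_zero hl hα (map_zero _)

theorem zero (N : ℤ) : HasLead (0 : FunField F q) N 0 := by
  rw [HasLead, map_zero]
  exact LeadAt.zero _

theorem add (hl : HasLead h N α) (hl' : HasLead h' N α') : HasLead (h + h') N (α + α') := by
  rw [HasLead, map_add]
  exact LeadAt.add hl hl'

theorem sub (hl : HasLead h N α) (hl' : HasLead h' N α') : HasLead (h - h') N (α - α') := by
  rw [HasLead, map_sub]
  exact LeadAt.sub hl hl'

theorem mul (hl : HasLead h N α) (hl' : HasLead h' N' α') :
    HasLead (h * h') (N + N') (α * α') := by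
  rw [HasLead, map_mul, neg_add]
  exact LeadAt.mul hl hl'

theorem pow (hl : HasLead h N α) (k : ℕ) : HasLead (h ^ k) (k * N) (α ^ k) := by
  rw [HasLead, map_pow, ← mul_neg, ← nsmul_eq_mul]
  exact LeadAt.pow hl k

theorem of_lt (hl : HasLead h N α) (hN : N < N') : HasLead h N' 0 :=
  LeadAt.of_lt hl (neg_lt_neg hN)

theorem exists_sub_one (hl : HasLead h N 0) : ∃ α, HasLead h (N - 1) α := by
  obtain ⟨α, hα⟩ := LeadAt.exists_add_one hl
  exact ⟨α, by rwa [HasLead, neg_sub', sub_neg_eq_add]⟩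

end HasLead

theorem hasLead_algebraMap (a : F) : HasLead (algebraMap F (FunField F q) a) 0 a := by
  rw [HasLead, IsScalarTower.algebraMap_apply F (CoordRing F q), expand_algebraMap,
    expandRing_algebraMap]
  exact LeadAt.const a

theorem hasLead_x : HasLead (ι x) q 1 := by
  rw [HasLead, expand_algebraMap, expandRing_x]
  exact leadAt_xSeries F q

theorem hasLead_y : HasLead (ι y) (q + 1) 1 := by
  rw [HasLead, expand_algebraMap, expandRing_y]
  exact leadAt_ySeries F q

theorem exists_hasLead_of_ne_zero {h : FunField F q} (hh : h ≠ 0) :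
    ∃ (N : ℤ) (α : F), α ≠ 0 ∧ HasLead h N α := by
  obtain ⟨n, α, hα, hl⟩ := LeadAt.exists_of_ne_zero
    ((map_ne_zero_iff _ (expand F q).injective).2 hh)
  exact ⟨-n, α, hα, by rwa [HasLead, neg_neg]⟩

theorem exists_hasLead_rho {f : CoordRing F q} (hf : f ≠ 0) :
    ∃ (N : ℤ) (α : F), α ≠ 0 ∧ rho f = N ∧ HasLead (ι f) N α := by
  simpa only [HasLead, expand_algebraMap] using exists_leadAt_expandRing hf

theorem HasLead.rho_eq {f : CoordRing F q} {N : ℤ} {α : F} (hl : HasLead (ι f) N α) (hα : α ≠ 0) :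
    rho f = N := by
  obtain ⟨M, β, hβ, hM, hl'⟩ := exists_hasLead_rho
    ((map_ne_zero_iff _ (IsFractionRing.injective _ (FunField F q))).1 (hl.ne_zero hα))
  rw [hM, neg_injective (LeadAt.eq_of_ne_zero hl' hβ hl hα)]

theorem HasLead.rho_lt {f : CoordRing F q} {N : ℤ} (hl : HasLead (ι f) N 0) : rho f < N := by
  rcases eq_or_ne f 0 with rfl | hf
  · rw [rho_zero]
    exact WithBot.bot_lt_coe N
  obtain ⟨M, β, hβ, hM, hl'⟩ := exists_hasLead_rho hf
  rw [hM, WithBot.coe_lt_coe]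
  refine (neg_le_neg_iff.1 (LeadAt.le_of_ne_zero hl hl' hβ)).lt_of_ne ?_
  rintro rfl
  exact hβ (hl'.unique hl)

theorem HasLead.rhoFrac_eq {h : FunField F q} {N : ℤ} {α : F} (hl : HasLead h N α) (hα : α ≠ 0) :
    rhoFrac h = N := by
  obtain ⟨M, β, hβ, hM, hden⟩ := exists_hasLead_rho (nonZeroDivisors.ne_zero
    (IsLocalization.sec (nonZeroDivisors (CoordRing F q)) h).2.2)
  have hnum := hl.mul hden
  rw [IsLocalization.sec_spec] at hnum
  rw [rhoFrac, hnum.rho_eq (mul_ne_zero hα hβ), ord, hM, WithBot.unbotD_coe, ← WithBot.coe_add,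
    add_neg_cancel_right]

theorem rhoFrac_zero : rhoFrac (0 : FunField F q) = ⊥ := by
  have hsec := IsLocalization.sec_spec (nonZeroDivisors (CoordRing F q)) (0 : FunField F q)
  rw [zero_mul, eq_comm, map_eq_zero_iff _ (IsFractionRing.injective _ _)] at hsec
  rw [rhoFrac, hsec, rho_zero, WithBot.bot_add]

theorem rhoFrac_le_iff {h : FunField F q} {N : ℤ} : rhoFrac h ≤ N ↔ ∃ α, HasLead h N α := by
  rcases eq_or_ne h 0 with rfl | hh
  · exact iff_of_true (rhoFrac_zero.trans_le bot_le) ⟨0, HasLead.zero N⟩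
  obtain ⟨M, β, hβ, hl⟩ := exists_hasLead_of_ne_zero hh
  rw [hl.rhoFrac_eq hβ, WithBot.coe_le_coe]
  refine ⟨fun hMN => ?_, fun ⟨α, hl'⟩ => neg_le_neg_iff.1 (LeadAt.le_of_ne_zero hl' hl hβ)⟩
  rcases hMN.eq_or_lt with rfl | hMN
  exacts [⟨β, hl⟩, ⟨0, hl.of_lt hMN⟩]

/-! ### Expansions in the star basis -/

theorem eval₂RingHom_x_injective :
    Function.Injective (eval₂RingHom (algebraMap F (FunField F q)) (ι x)) := by
  have hcomp : (expand F q).comp (eval₂RingHom (algebraMap F (FunField F q)) (ι x)) =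
      eval₂RingHom HahnSeries.C (xSeries F q) := by
    refine Polynomial.ringHom_ext (fun a => ?_) ?_
    · rw [RingHom.comp_apply, coe_eval₂RingHom, coe_eval₂RingHom, eval₂_C, eval₂_C,
        IsScalarTower.algebraMap_apply F (CoordRing F q), expand_algebraMap, expandRing_algebraMap]
    · rw [RingHom.comp_apply, coe_eval₂RingHom, coe_eval₂RingHom, eval₂_X, eval₂_X,
        expand_algebraMap, expandRing_x]
  refine Function.Injective.of_comp (f := expand F q) ?_
  rw [← RingHom.coe_comp, hcomp]
  exact LeadAt.eval₂RingHom_injective (leadAt_xSeries F q) (by exact_mod_cast (one_lt_q q).le)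

variable (F q) in
/-- The embedding `ofRatFunc` of `F(x)` into `F(x,y)`, as a ring homomorphism. -/
def ofRatFuncHom : RatFunc F →+* FunField F q :=
  ratFuncEvalHom (algebraMap F (FunField F q)) (ι x) eval₂RingHom_x_injective

theorem ofRatFuncHom_apply (c : RatFunc F) : ofRatFuncHom F q c = ofRatFunc c :=
  ratFuncEvalHom_apply _ _ _ c

theorem ofRatFuncHom_C (a : F) :
    ofRatFuncHom F q (RatFunc.C a) = algebraMap F (FunField F q) a := by
  rw [ofRatFuncHom_apply, ofRatFunc, RatFunc.eval_C]

theorem ofRatFuncHom_X : ofRatFuncHom F q RatFunc.X = ι x := by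
  rw [ofRatFuncHom_apply, ofRatFunc, RatFunc.eval_X]

theorem ofRatFuncHom_algebraMap (p : F[X]) :
    ofRatFuncHom F q (algebraMap F[X] (RatFunc F) p) = ι (AdjoinRoot.of _ p) := by
  rw [of_eq_sum, ratFunc_algebraMap_eq_sum, map_sum, map_sum]
  refine Finset.sum_congr rfl fun a _ => ?_
  rw [map_mul, map_mul, map_pow, map_pow, ofRatFuncHom_C, ofRatFuncHom_X,
    IsScalarTower.algebraMap_apply F (CoordRing F q)]

theorem hasLead_ofRatFuncHom (c : RatFunc F) :
    HasLead (ofRatFuncHom F q c) (c.intDegree * q) c.num.leadingCoeff := by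
  have hexpand : expand F q (ofRatFuncHom F q c) = c.eval HahnSeries.C (xSeries F q) := by
    have hC : (expand F q).comp (algebraMap F (FunField F q)) = HahnSeries.C := by
      ext1 a
      rw [RingHom.comp_apply, IsScalarTower.algebraMap_apply F (CoordRing F q), expand_algebraMap,
        expandRing_algebraMap]
    rw [ofRatFuncHom_apply, ofRatFunc, RatFunc.eval, RatFunc.eval, map_div₀, hom_eval₂, hom_eval₂,
      hC, expand_algebraMap, expandRing_x]
  rw [HasLead, hexpand, mul_comm]
  exact LeadAt.ratFuncEval (leadAt_xSeries F q) (by exact_mod_cast (one_lt_q q).le) c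

omit [Fact (IsPrimePow q)] in
theorem termOrder_injective {a a' : ℤ} {b b' : Fin q} (h : termOrder a b = termOrder a' b') :
    a = a' ∧ b = b' := by
  rw [termOrder, termOrder] at h
  obtain ⟨ha, hb⟩ := weight_injective b'.2 b.2 (a := a) (a' := a') (by linear_combination h)
  exact ⟨ha, Fin.ext hb.symm⟩

variable (q) in
theorem exists_termOrder_eq (N : ℤ) : ∃ (a : ℤ) (b : Fin q), termOrder a b = N := by
  have hq : (0 : ℤ) < q := by exact_mod_cast (one_lt_q q).le
  have hnonneg := Int.emod_nonneg (-1 - N) hq.ne'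
  have hlt := Int.emod_lt_of_pos (-1 - N) hq
  refine ⟨-((-1 - N) / q) - q + (-1 - N) % q, ⟨((-1 - N) % q).toNat, by omega⟩, ?_⟩
  rw [termOrder]
  simp only [Int.toNat_of_nonneg hnonneg]
  linear_combination -Int.emod_add_mul_ediv (-1 - N) q

theorem hasLead_zstar (b : Fin q) : HasLead (ι (zstar b)) (termOrder 0 b) 1 := by
  have hq := one_lt_q q
  have hord : termOrder 0 b = ((q - 1 - b : ℕ) : ℤ) * (q + 1) := by
    rw [termOrder, Nat.sub_sub, Nat.cast_sub (by omega)]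
    push_cast
    ring
  have hpow : HasLead (ι (y ^ (q - 1 - (b : ℕ)))) (termOrder 0 b) 1 := by
    simpa only [map_pow, hord, one_pow] using (hasLead_y (F := F) (q := q)).pow (q - 1 - b)
  rw [zstar]
  split_ifs with hb
  · rw [hb, Nat.sub_zero] at hpow hord
    have hpos : 0 < termOrder 0 b := by
      rw [hord]
      exact mul_pos (by omega) (by omega)
    simpa using hpow.add ((hasLead_algebraMap (q := q) (1 : F)).of_lt hpos)
  · exact hpow

theorem isStarExpansion_iff {h : FunField F q} {c : Fin q → RatFunc F} :
    IsStarExpansion h c ↔ h = ∑ b, ofRatFuncHom F q (c b) * ι (zstar b) := by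
  simp only [IsStarExpansion, ofRatFuncHom_apply]

theorem isStarExpansion_zero : IsStarExpansion (0 : FunField F q) 0 := by
  simp only [isStarExpansion_iff, Pi.zero_apply, map_zero, zero_mul, Finset.sum_const_zero]

theorem isStarExpansion_zstar (b : Fin q) : IsStarExpansion (ι (zstar b)) (Pi.single b 1) := by
  rw [isStarExpansion_iff, Finset.sum_eq_single_of_mem b (Finset.mem_univ b) fun c _ hc => by
    rw [Pi.single_eq_of_ne hc, map_zero, zero_mul], Pi.single_eq_same, map_one, one_mul]

omit [Fact (IsPrimePow q)] in
theorem exists_forall_termOrder_lt_laurentCoeff_eq_zero (c : Fin q → RatFunc F) :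
    ∃ M : ℤ, ∀ a b, M < termOrder a b → laurentCoeff (c b) a = 0 := by
  obtain ⟨M, hM⟩ := Finite.bddAbove_range fun b => termOrder (c b).intDegree b
  refine ⟨M, fun a b hlt => laurentCoeff_of_intDegree_lt ?_⟩
  have : termOrder (c b).intDegree b < termOrder a b := (hM ⟨b, rfl⟩).trans_lt hlt
  rw [termOrder, termOrder, add_lt_add_iff_right] at this
  exact lt_of_mul_lt_mul_right this (Nat.cast_nonneg q)

namespace IsStarExpansion

variable {h h' : FunField F q} {c c' : Fin q → RatFunc F}

theorem add (hc : IsStarExpansion h c) (hc' : IsStarExpansion h' c') :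
    IsStarExpansion (h + h') (c + c') := by
  rw [isStarExpansion_iff] at *
  simp only [hc, hc', Pi.add_apply, map_add, add_mul, Finset.sum_add_distrib]

theorem mul (hc : IsStarExpansion h c) (u : RatFunc F) :
    IsStarExpansion (ofRatFuncHom F q u * h) fun b => u * c b := by
  rw [isStarExpansion_iff] at *
  simp only [hc, Finset.mul_sum, map_mul, mul_assoc]

theorem hasLead (hc : IsStarExpansion h c) {a : ℤ} {b : Fin q}
    (hab : ∀ a' b', termOrder a b < termOrder a' b' → laurentCoeff (c b') a' = 0) :
    HasLead h (termOrder a b) (laurentCoeff (c b) a) := by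
  have hasLead_summand (b' : Fin q) : HasLead (ofRatFuncHom F q (c b') * ι (zstar b'))
      (termOrder (c b').intDegree b') (laurentCoeff (c b') (c b').intDegree) := by
    rw [laurentCoeff_intDegree]
    convert (hasLead_ofRatFuncHom (q := q) (c b')).mul (hasLead_zstar b') using 1
    · rw [termOrder, termOrder]
      ring
    · rw [mul_one]
  have eq_zero_or_le (b' : Fin q) :
      c b' = 0 ∨ termOrder (c b').intDegree b' ≤ termOrder a b := by
    refine or_iff_not_imp_right.2 fun hlt => ?_
    have := hab _ _ (not_le.1 hlt)
    rwa [laurentCoeff_intDegree, leadingCoeff_eq_zero, RatFunc.num_eq_zero_iff] at this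
  rw [HasLead, isStarExpansion_iff.1 hc, map_sum]
  refine LeadAt.sum_of_dominant (Finset.mem_univ b) ?_ fun b' _ hne => ?_
  · rcases eq_zero_or_le b with hb | hb
    · rw [hb, map_zero, zero_mul, map_zero, laurentCoeff_zero]
      exact LeadAt.zero _
    rcases hb.eq_or_lt with heq | hlt
    · have := hasLead_summand b
      rwa [(termOrder_injective heq).1] at this
    · have hdeg : (c b).intDegree < a := by
        rw [termOrder, termOrder, add_lt_add_iff_right] at hlt
        exact lt_of_mul_lt_mul_right hlt (Nat.cast_nonneg q)
      rw [laurentCoeff_of_intDegree_lt hdeg]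
      exact (hasLead_summand b).of_lt hlt
  · rcases eq_zero_or_le b' with hb' | hb'
    · rw [hb', map_zero, zero_mul, map_zero]
      exact LeadAt.zero _
    · exact (hasLead_summand b').of_lt
        (hb'.lt_of_ne fun heq => hne (termOrder_injective heq).2)

/-- Descending induction on the order: the largest term that occurs cancels with no other, so it
would be a leading term of `h`. -/
theorem laurentCoeff_eq_zero_of_hasLead (hc : IsStarExpansion h c) {N : ℤ} {α : F}
    (hl : HasLead h N α) {a : ℤ} {b : Fin q} (hN : N < termOrder a b) :
    laurentCoeff (c b) a = 0 := by
  obtain ⟨M, hM⟩ := exists_forall_termOrder_lt_laurentCoeff_eq_zero c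
  suffices hind : ∀ k ≤ max M N, N ≤ k → ∀ a b, k < termOrder a b → laurentCoeff (c b) a = 0 from
    hind N (le_max_right _ _) le_rfl a b hN
  intro k hk
  induction k, hk using Int.leInductionDown with
  | base => exact fun _ a b hlt => hM a b ((le_max_left _ _).trans_lt hlt)
  | pred k hk ih =>
    intro hNk a b hlt
    rcases (Int.sub_one_lt_iff.1 hlt).eq_or_lt with rfl | hlt
    · exact (hc.hasLead (ih (by omega))).unique (hl.of_lt (by omega))
    · exact ih (by omega) a b hlt

theorem laurentCoeff_of_hasLead (hc : IsStarExpansion h c) {a : ℤ} {b : Fin q} {α : F}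
    (hl : HasLead h (termOrder a b) α) : laurentCoeff (c b) a = α :=
  (hc.hasLead fun _ _ => hc.laurentCoeff_eq_zero_of_hasLead hl).unique hl

theorem isStarMonic (hc : IsStarExpansion h c) {N : ℤ} (hl : HasLead h N 1) : IsStarMonic h := by
  obtain ⟨a, b, rfl⟩ := exists_termOrder_eq q N
  refine ⟨c, hc, a, b, hc.laurentCoeff_of_hasLead hl, fun a' b' hne => ?_⟩
  by_contra! hlt
  exact hne (hc.laurentCoeff_eq_zero_of_hasLead hl hlt)

end IsStarExpansion

namespace StarTermsAtLeast

variable {φ φ' : CoordRing F q} {N N' : ℤ}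

theorem mono (hφ : StarTermsAtLeast φ N) (hN : N' ≤ N) : StarTermsAtLeast φ N' :=
  let ⟨c, hc, hmin⟩ := hφ
  ⟨c, hc, fun a b hab => hN.trans (hmin a b hab)⟩

theorem zero (N : ℤ) : StarTermsAtLeast (0 : CoordRing F q) N :=
  ⟨0, by rw [map_zero]; exact isStarExpansion_zero, fun a _ hab => absurd (laurentCoeff_zero a) hab⟩

theorem add (hφ : StarTermsAtLeast φ N) (hφ' : StarTermsAtLeast φ' N) :
    StarTermsAtLeast (φ + φ') N := by
  obtain ⟨c, hc, hmin⟩ := hφ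
  obtain ⟨c', hc', hmin'⟩ := hφ'
  refine ⟨c + c', by rw [map_add]; exact hc.add hc', fun a b hab => ?_⟩
  rw [Pi.add_apply, laurentCoeff_add] at hab
  by_cases hzero : laurentCoeff (c b) a = 0
  · exact hmin' a b fun hzero' => hab (by rw [hzero, hzero', add_zero])
  · exact hmin a b hzero

theorem const_mul (hφ : StarTermsAtLeast φ N) (r : F) :
    StarTermsAtLeast (algebraMap F (CoordRing F q) r * φ) N := by
  obtain ⟨c, hc, hmin⟩ := hφ
  refine ⟨fun b => RatFunc.C r * c b, ?_, fun a b hab => hmin a b fun hzero => hab ?_⟩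
  · rw [map_mul, ← IsScalarTower.algebraMap_apply F (CoordRing F q), ← ofRatFuncHom_C]
    exact hc.mul _
  · rw [laurentCoeff_C_mul, hzero, mul_zero]

theorem neg (hφ : StarTermsAtLeast φ N) : StarTermsAtLeast (-φ) N := by
  simpa only [map_neg, map_one, neg_mul, one_mul] using hφ.const_mul (-1)

theorem x_pow_mul (hφ : StarTermsAtLeast φ N) (k : ℕ) :
    StarTermsAtLeast (x ^ k * φ) (k * q + N) := by
  obtain ⟨c, hc, hmin⟩ := hφ
  refine ⟨fun b => RatFunc.X ^ k * c b, ?_, fun a b hab => ?_⟩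
  · rw [map_mul, map_pow, ← ofRatFuncHom_X, ← map_pow]
    exact hc.mul _
  · rw [laurentCoeff_X_pow_mul] at hab
    have := hmin _ b hab
    rw [termOrder] at this ⊢
    linarith

end StarTermsAtLeast

theorem starTermsAtLeast_zstar (b : Fin q) :
    StarTermsAtLeast (zstar b : CoordRing F q) (termOrder 0 b) := by
  refine ⟨Pi.single b 1, isStarExpansion_zstar b, fun a b' hab => ?_⟩
  rcases eq_or_ne b' b with rfl | hb
  · rw [Pi.single_eq_same, laurentCoeff_one, ite_ne_right_iff] at hab
    rw [hab.1]
  · rw [Pi.single_eq_of_ne hb, laurentCoeff_zero] at hab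
    exact absurd rfl hab

/-! ### The coordinate at the first element of the star basis -/

instance : NeZero q := ⟨(one_lt_q q).ne_bot⟩

/-- `h` has a `∗`-expansion whose coordinate at `z∗_0` is `u`. This coordinate is the linear form
for which `z∗_0, …, z∗_(q-1)` is the dual basis of `1, y, …, y^(q-1)`. -/
def HasZeroCoord (h : FunField F q) (u : RatFunc F) : Prop :=
  ∃ c : Fin q → RatFunc F, IsStarExpansion h c ∧ c 0 = u

namespace HasZeroCoord

variable {h h' : FunField F q} {u u' : RatFunc F}

theorem zero : HasZeroCoord (0 : FunField F q) 0 := ⟨0, isStarExpansion_zero, rfl⟩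

theorem add (hu : HasZeroCoord h u) (hu' : HasZeroCoord h' u') :
    HasZeroCoord (h + h') (u + u') := by
  obtain ⟨c, hc, rfl⟩ := hu
  obtain ⟨c', hc', rfl⟩ := hu'
  exact ⟨c + c', hc.add hc', rfl⟩

theorem mul (hu : HasZeroCoord h u) (v : RatFunc F) :
    HasZeroCoord (ofRatFuncHom F q v * h) (v * u) := by
  obtain ⟨c, hc, rfl⟩ := hu
  exact ⟨_, hc.mul v, rfl⟩

theorem x_pow_mul (hu : HasZeroCoord h u) (k : ℕ) :
    HasZeroCoord (ι x ^ k * h) (RatFunc.X ^ k * u) := by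
  rw [← ofRatFuncHom_X, ← map_pow]
  exact hu.mul _

theorem sub (hu : HasZeroCoord h u) (hu' : HasZeroCoord h' u') :
    HasZeroCoord (h - h') (u - u') := by
  have := hu.add (hu'.mul (-1))
  rwa [map_neg, map_one, neg_one_mul, neg_one_mul, ← sub_eq_add_neg, ← sub_eq_add_neg] at this

theorem sum {τ : Type*} {s : Finset τ} {h : τ → FunField F q} {u : τ → RatFunc F}
    (hu : ∀ t ∈ s, HasZeroCoord (h t) (u t)) : HasZeroCoord (∑ t ∈ s, h t) (∑ t ∈ s, u t) := by
  classical
  induction s using Finset.induction_on with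
  | empty => exact zero
  | insert t s ht ih =>
    rw [Finset.sum_insert ht, Finset.sum_insert ht]
    exact (hu t (Finset.mem_insert_self _ _)).add
      (ih fun t' ht' => hu t' (Finset.mem_insert_of_mem ht'))

theorem laurentCoeff_of_hasLead (hu : HasZeroCoord h u) {a : ℤ} {α : F}
    (hl : HasLead h (termOrder a (0 : Fin q)) α) : laurentCoeff u a = α := by
  obtain ⟨c, hc, rfl⟩ := hu
  exact hc.laurentCoeff_of_hasLead hl

end HasZeroCoord

theorem hasZeroCoord_zstar (b : Fin q) :
    HasZeroCoord (ι (zstar b)) (if (b : ℕ) = 0 then 1 else 0) :=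
  ⟨_, isStarExpansion_zstar b, by
    simp only [Pi.single_apply, eq_comm (a := (0 : Fin q)), Fin.ext_iff, Fin.val_zero]⟩

theorem hasZeroCoord_y_pow_of_lt {k : ℕ} (hk : k < q - 1) :
    HasZeroCoord (ι y ^ k : FunField F q) 0 := by
  have := hasZeroCoord_zstar (F := F) (⟨q - 1 - k, by omega⟩ : Fin q)
  rwa [if_neg (Nat.sub_pos_of_lt hk).ne', zstar, if_neg (Nat.sub_pos_of_lt hk).ne',
    Nat.sub_sub_self hk.le, map_pow] at this

theorem hasZeroCoord_y_pow_sub_one : HasZeroCoord (ι y ^ (q - 1) : FunField F q) 1 := by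
  have hone := hasZeroCoord_y_pow_of_lt (F := F) (Nat.sub_pos_of_lt (one_lt_q q))
  have := (hasZeroCoord_zstar (F := F) (0 : Fin q)).sub hone
  rwa [Fin.val_zero, if_pos rfl, zstar, Fin.val_zero, if_pos rfl, map_add, map_one, map_pow,
    pow_zero, add_sub_cancel_right, sub_zero] at this

omit [Fact (IsPrimePow q)] in
theorem x_pow_succ_eq : (x : CoordRing F q) ^ (q + 1) = y ^ q + y := by
  have h := AdjoinRoot.mk_self (f := curvePoly F q)
  conv_lhs at h => arg 2; rw [curvePoly]
  rw [map_sub, map_add, map_pow, sub_eq_zero] at h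
  rw [x, ← map_pow]
  exact h.symm

theorem hasZeroCoord_y_pow_mul_zstar {b : ℕ} (hb : b < q) (c : Fin q) :
    HasZeroCoord (ι y ^ b * ι (zstar c)) (if b = c then 1 else 0) := by
  have hq := one_lt_q q
  have hcq := c.2
  have hcurve : (ι x : FunField F q) ^ (q + 1) = ι y ^ q + ι y := by
    rw [← map_pow, x_pow_succ_eq, map_add, map_pow]
  rcases eq_or_ne (c : ℕ) 0 with hc | hc
  · rcases b with _ | b
    · rw [if_pos hc.symm, pow_zero, one_mul]
      simpa only [if_pos hc] using hasZeroCoord_zstar (F := F) c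
    · have hmul : (ι y : FunField F q) ^ (b + 1) * ι (zstar c) = ι x ^ (q + 1) * ι y ^ b := by
        rw [hcurve, zstar, if_pos hc, map_add, map_one, map_pow, mul_add, ← pow_add,
          show b + 1 + (q - 1) = q + b by omega]
        ring
      rw [if_neg (by omega), hmul]
      simpa only [mul_zero] using
        (hasZeroCoord_y_pow_of_lt (F := F) (k := b) (by omega)).x_pow_mul (q + 1)
  rw [zstar, if_neg hc, map_pow, ← pow_add]
  rcases lt_trichotomy b c with hlt | heq | hgt
  · rw [if_neg hlt.ne]
    exact hasZeroCoord_y_pow_of_lt (by omega)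
  · rw [if_pos heq, show b + (q - 1 - c) = q - 1 by omega]
    exact hasZeroCoord_y_pow_sub_one
  · obtain ⟨k, rfl⟩ := Nat.exists_eq_add_of_lt hgt
    have hpow : (ι y : FunField F q) ^ (c + k + 1 + (q - 1 - c)) =
        ι x ^ (q + 1) * ι y ^ k - ι y ^ (k + 1) := by
      rw [hcurve, show (c : ℕ) + k + 1 + (q - 1 - c) = q + k by omega]
      ring
    rw [if_neg hgt.ne', hpow]
    simpa only [mul_zero, sub_zero] using
      ((hasZeroCoord_y_pow_of_lt (F := F) (k := k) (by omega)).x_pow_mul (q + 1)).sub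
        (hasZeroCoord_y_pow_of_lt (k := k + 1) (by omega))

namespace IsStarExpansion

variable {h : FunField F q} {c : Fin q → RatFunc F}

theorem hasZeroCoord_y_pow_mul (hc : IsStarExpansion h c) (b : Fin q) :
    HasZeroCoord (ι y ^ (b : ℕ) * h) (c b) := by
  have := HasZeroCoord.sum (s := Finset.univ) fun b' _ =>
    (hasZeroCoord_y_pow_mul_zstar (F := F) b.2 b').mul (c b')
  simp only [← Fin.ext_iff, mul_ite, mul_one, mul_zero, Finset.sum_ite_eq, Finset.mem_univ,
    if_true, mul_left_comm _ (ι y ^ (b : ℕ)), ← Finset.mul_sum] at this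
  rwa [← isStarExpansion_iff.1 hc] at this

theorem hasZeroCoord_mul (hc : IsStarExpansion h c) (f : CoordRing F q) :
    HasZeroCoord (ι f * h) (∑ b : Fin q, algebraMap F[X] (RatFunc F) (yCoeff f b) * c b) := by
  have hmul : ι f * h = ∑ b : Fin q,
      ofRatFuncHom F q (algebraMap F[X] (RatFunc F) (yCoeff f b)) * (ι y ^ (b : ℕ) * h) := by
    conv_lhs => rw [eq_sum_yCoeff f,
      Finset.sum_range fun b => AdjoinRoot.of (curvePoly F q) (yCoeff f b) * y ^ b, map_sum,
      Finset.sum_mul]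
    simp only [map_mul, map_pow, ofRatFuncHom_algebraMap, mul_assoc]
  rw [hmul]
  exact HasZeroCoord.sum fun b _ => (hc.hasZeroCoord_y_pow_mul b).mul _

end IsStarExpansion

theorem hasZeroCoord_algebraMap (f : CoordRing F q) :
    HasZeroCoord (ι f) (algebraMap F[X] (RatFunc F) (yCoeff f (q - 1))) := by
  have hq := one_lt_q q
  let l : Fin q := ⟨q - 1, by omega⟩
  have hone : (zstar l : CoordRing F q) = 1 := by
    rw [zstar, if_neg (Nat.sub_pos_of_lt hq).ne', Nat.sub_self, pow_zero]
  have := (isStarExpansion_zstar (F := F) l).hasZeroCoord_mul f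
  rwa [hone, map_one, mul_one, Finset.sum_eq_single_of_mem l (Finset.mem_univ l) fun b _ hb => by
    rw [Pi.single_eq_of_ne hb, mul_zero], Pi.single_eq_same, mul_one] at this

/-! ### The syndrome -/

theorem y_sub_mul_sum_zstar {α β : F} (h : α ^ (q + 1) = β ^ q + β) :
    ((y : CoordRing F q) - algebraMap F _ β) * ∑ b : Fin q, algebraMap F _ β ^ (b : ℕ) * zstar b =
      x ^ (q + 1) - algebraMap F _ α ^ (q + 1) := by
  have hzstar (b : Fin q) : algebraMap F (CoordRing F q) β ^ (b : ℕ) * zstar b =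
      algebraMap F _ β ^ (b : ℕ) * y ^ (q - 1 - (b : ℕ)) + if b = 0 then 1 else 0 := by
    rw [zstar]
    rcases eq_or_ne b 0 with rfl | hb
    · simp only [Fin.val_zero, if_true, pow_zero, one_mul, Nat.sub_zero]
    · rw [if_neg hb, if_neg (Fin.val_ne_zero_iff.2 hb), add_zero]
  rw [Finset.sum_congr rfl fun b _ => hzstar b, Finset.sum_add_distrib, Finset.sum_ite_eq',
    if_pos (Finset.mem_univ _),
    Fin.sum_univ_eq_sum_range (fun b => algebraMap F (CoordRing F q) β ^ b * y ^ (q - 1 - b)) q,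
    x_pow_succ_eq, ← map_pow, h, map_add, map_pow]
  linear_combination -geom_sum₂_mul (algebraMap F (CoordRing F q) β) y q

theorem y_sub_algebraMap_ne_zero (β : F) : ι y - algebraMap F (FunField F q) β ≠ 0 := by
  have := hasLead_y.sub ((hasLead_algebraMap (q := q) β).of_lt (by omega : (0 : ℤ) < q + 1))
  exact this.ne_zero (by rw [sub_zero]; exact one_ne_zero)

section Syndrome

variable [Finite F]

omit [Fact (IsPrimePow q)] in
/-- The coordinate of the syndrome at `z∗_b`, for which dividing
`x ^ (q + 1) - α ^ (q + 1) = (y ^ q + y) - (β ^ q + β)` by `y - β` gives a geometric sum. -/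
def syndCoord (e : Point F q → F) (b : Fin q) : RatFunc F :=
  ∑ P : Point F q, RatFunc.C (e P * P.1.2 ^ (b : ℕ)) * (RatFunc.X - RatFunc.C P.1.1)⁻¹

omit [Fact (IsPrimePow q)] in
theorem laurentCoeff_syndCoord (e : Point F q → F) (b : Fin q) (k : ℤ) :
    laurentCoeff (syndCoord e b) (-1 - k) = synd e k b := by
  simp only [syndCoord, laurentCoeff_sum, synd, laurentCoeff_C_mul, laurentCoeff_inv_X_sub_C]
  split_ifs with hk
  · simp only [mul_right_comm]
  · simp only [mul_zero, Finset.sum_const_zero]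

variable (e : Point F q → F)

theorem isStarExpansion_syndrome : IsStarExpansion (syndrome e) (syndCoord e) := by
  rw [isStarExpansion_iff]
  simp only [syndCoord, map_sum, Finset.sum_mul]
  rw [Finset.sum_comm, syndrome]
  refine Finset.sum_congr rfl fun P _ => ?_
  have hP := congrArg ι (y_sub_mul_sum_zstar P.2)
  rw [map_mul, map_sub, map_sub, map_pow, map_pow, ← IsScalarTower.algebraMap_apply,
    ← IsScalarTower.algebraMap_apply, map_sum] at hP
  rw [← hP, mul_comm (_ - algebraMap F (FunField F q) P.1.1),
    mul_div_mul_left _ _ (y_sub_algebraMap_ne_zero P.1.2), Finset.sum_div, Finset.mul_sum]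
  refine Finset.sum_congr rfl fun b _ => ?_
  rw [map_mul, map_mul, map_inv₀, map_sub, ofRatFuncHom_X, ofRatFuncHom_C, ofRatFuncHom_C, map_mul,
    map_pow, map_pow, ← IsScalarTower.algebraMap_apply]
  ring

theorem hasLead_syndrome : HasLead (syndrome e) ((q : ℤ) ^ 2 - q - 1) (synd e 0 0) := by
  have hvanish (a : ℤ) (b : Fin q) (hlt : termOrder (-1) (0 : Fin q) < termOrder a b) :
      laurentCoeff (syndCoord e b) a = 0 := by
    have ha : 0 ≤ a := by
      by_contra! ha
      rw [termOrder, termOrder, Fin.val_zero] at hlt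
      have := mul_le_mul_of_nonneg_right (Int.le_sub_one_iff.2 ha) (Nat.cast_nonneg (α := ℤ) q)
      have : (0 : ℤ) ≤ (b : ℕ) * (q + 1) := by positivity
      push_cast at hlt
      linarith
    have := laurentCoeff_syndCoord e b (-1 - a)
    rwa [sub_sub_cancel, synd, if_neg (by omega)] at this
  have := (isStarExpansion_syndrome e).hasLead hvanish
  convert this using 1
  · rw [termOrder, Fin.val_zero]
    push_cast
    ring
  · exact (laurentCoeff_syndCoord e 0 0).symm

theorem exists_isStarExpansion_keyDiff (f φ : CoordRing F q) :
    ∃ c, IsStarExpansion (keyDiff (syndrome e) f φ) c :=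
  let ⟨c, hc, _⟩ := ((isStarExpansion_syndrome e).hasZeroCoord_mul f).sub
    (hasZeroCoord_algebraMap φ)
  ⟨c, hc⟩

theorem laurentCoeff_sum_yCoeff_mul_syndCoord (h : CoordRing F q) (r : ℤ) :
    laurentCoeff (∑ b : Fin q, algebraMap F[X] (RatFunc F) (yCoeff h b) * syndCoord e b) (-1 - r) =
      ∑ c ∈ Finset.range q, ∑ a ∈ xSupport h c, coef h a c * synd e ((a : ℤ) + r) c := by
  rw [laurentCoeff_sum, Finset.sum_range]
  refine Finset.sum_congr rfl fun b _ => ?_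
  rw [laurentCoeff_algebraMap_mul]
  refine Finset.sum_congr rfl fun a _ => ?_
  rw [← laurentCoeff_syndCoord, show -1 - ((a : ℤ) + r) = -1 - r - a by ring]
  rfl

/-- Multiplication by `y ^ j` moves the coordinate of `f S - φ` at `z∗_j` to `z∗_0`, where `φ` does
not contribute. -/
theorem discrepancy_eq {f φ : CoordRing F q} {r : ℤ} {j : Fin q} {α : F}
    (hl : HasLead (keyDiff (syndrome e) f φ) (termOrder (-1 - r) j) α)
    (hφ : StarTermsAtLeast φ (termOrder (-1 - r) j + 1)) :
    ∑ c ∈ Finset.range q, ∑ a ∈ xSupport (y ^ (j : ℕ) * f) c,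
      coef (y ^ (j : ℕ) * f) a c * synd e ((a : ℤ) + r) c = α := by
  obtain ⟨c, hc, hmin⟩ := hφ
  have hcoord := ((isStarExpansion_syndrome e).hasZeroCoord_mul (y ^ (j : ℕ) * f)).sub
    (hc.hasZeroCoord_y_pow_mul j)
  have hmul : ι (y ^ (j : ℕ) * f) * syndrome e - ι y ^ (j : ℕ) * ι φ =
      ι y ^ (j : ℕ) * keyDiff (syndrome e) f φ := by
    rw [keyDiff, map_mul, map_pow]
    ring
  have hlead := (hasLead_y.pow j).mul hl
  rw [one_pow, one_mul, ← hmul, show (j : ℕ) * ((q : ℤ) + 1) + termOrder (-1 - r) j =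
    termOrder (-1 - r) (0 : Fin q) by rw [termOrder, termOrder, Fin.val_zero]; push_cast; ring]
    at hlead
  have hφ_coeff : laurentCoeff (c j) (-1 - r) = 0 := by
    by_contra hne
    exact (hmin _ _ hne).not_gt (lt_add_one _)
  rw [← hcoord.laurentCoeff_of_hasLead hlead, laurentCoeff_sub, hφ_coeff, sub_zero,
    laurentCoeff_sum_yCoeff_mul_syndCoord]

end Syndrome

/-! ### Approximate solutions of the key equation -/

section KeyEquation

variable {S : FunField F q} {K L : ℤ} {f φ g ψ : CoordRing F q}

omit [Fact (IsPrimePow q)] in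
theorem keyDiff_mul_sub_mul (u v : CoordRing F q) :
    keyDiff S (u * f - v * g) (u * φ - v * ψ) = ι u * keyDiff S f φ - ι v * keyDiff S g ψ := by
  simp only [keyDiff, map_sub, map_mul]
  ring

theorem HasLead.x_pow_mul {h : FunField F q} {N : ℤ} {α : F} (hl : HasLead h N α) (k : ℕ) :
    HasLead (ι (x ^ k) * h) (k * q + N) α := by
  simpa only [map_pow, one_pow, one_mul] using (hasLead_x.pow k).mul hl

theorem HasLead.const_mul {h : FunField F q} {N : ℤ} {α : F} (hl : HasLead h N α) (c : F) :
    HasLead (ι (algebraMap F _ c) * h) N (c * α) := by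
  rw [← IsScalarTower.algebraMap_apply, ← zero_add N]
  exact (hasLead_algebraMap c).mul hl

theorem HasLead.keyDiff_const_mul {N : ℤ} {α : F} (hl : HasLead (keyDiff S f φ) N α) (c : F) :
    HasLead (keyDiff S (algebraMap F _ c * f) (algebraMap F _ c * φ)) N (c * α) := by
  convert hl.const_mul c using 1
  simp only [keyDiff, map_mul]
  ring

theorem HasLead.x_pow_mul_sub {h h' : FunField F q} {N N' : ℤ} {α α' : F} (hl : HasLead h N α)
    (hl' : HasLead h' N' α') {k l : ℕ} (hN : (k * q + N : ℤ) = l * q + N') (c : F) :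
    HasLead (ι (x ^ k) * h - ι (algebraMap F _ c * x ^ l) * h') (k * q + N) (α - c * α') := by
  rw [map_mul, mul_assoc]
  exact (hl.x_pow_mul k).sub (hN ▸ (hl'.x_pow_mul l).const_mul c)

/-- The two products `f' (f S - φ)` and `f (f' S - φ')` differ by an element of `F[x,y]`, whose
coordinate at `z∗_0` is a polynomial and so has no terms of negative degree in `x`. -/
theorem eq_of_hasLead_keyDiff {f' φ' : CoordRing F q} {d d' N N' a : ℤ} {α α' : F}
    (hf : HasLead (ι f) d 1) (hf' : HasLead (ι f') d' 1) (hl : HasLead (keyDiff S f φ) N α)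
    (hl' : HasLead (keyDiff S f' φ') N' α') (ha : a < 0)
    (hN : d' + N = termOrder a (0 : Fin q)) (hN' : d + N' = termOrder a (0 : Fin q)) :
    α = α' := by
  have hdiff := (hN ▸ hf'.mul hl).sub (hN' ▸ hf.mul hl')
  have heq : ι f' * keyDiff S f φ - ι f * keyDiff S f' φ' = ι (f * φ' - f' * φ) := by
    simp only [keyDiff, map_sub, map_mul]
    ring
  rw [heq, one_mul, one_mul] at hdiff
  have := (hasZeroCoord_algebraMap _).laurentCoeff_of_hasLead hdiff
  rw [laurentCoeff_algebraMap_of_neg _ ha] at this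
  exact sub_eq_zero.1 this.symm

theorem solvesKeyEq_iff_of_ne_zero (hf : f ≠ 0) : SolvesKeyEq S K f φ ↔
    (∃ μ, HasLead (keyDiff S f φ) ((q : ℤ) ^ 2 - q - 1 - K) μ) ∧
      StarTermsAtLeast φ ((q : ℤ) ^ 2 - q - K) := by
  simp only [SolvesKeyEq, hf, ne_eq, not_false_eq_true, true_and, false_and, or_false,
    rhoFrac_le_iff]

namespace SolvesKeyEq

theorem starTermsAtLeast (h : SolvesKeyEq S K f φ) :
    StarTermsAtLeast φ ((q : ℤ) ^ 2 - q - 1 - K) := by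
  rcases h with ⟨-, -, hφ⟩ | ⟨-, a, b, ha, rfl, hφ⟩
  · exact hφ.mono (by omega)
  have hterm := (starTermsAtLeast_zstar (F := F) b).x_pow_mul (-a - 1).toNat
  rw [Int.toNat_of_nonneg (by omega), termOrder,
    show (-a - 1) * (q : ℤ) + (0 * q + ((q : ℤ) ^ 2 - 1 - (b : ℕ) * (q + 1))) =
      (q : ℤ) ^ 2 - q - 1 - (a * q + (b : ℕ) * (q + 1)) by ring] at hterm
  rcases hφ with rfl | rfl
  exacts [hterm, hterm.neg]

theorem add_one (h : SolvesKeyEq S K f φ) (hf : f ≠ 0)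
    (hl : HasLead (keyDiff S f φ) ((q : ℤ) ^ 2 - q - 1 - K) 0) : SolvesKeyEq S (K + 1) f φ := by
  rw [solvesKeyEq_iff_of_ne_zero hf] at h ⊢
  rw [← sub_sub, ← sub_sub]
  exact ⟨hl.exists_sub_one, h.2.mono (sub_le_self _ zero_le_one)⟩

theorem const_mul (h : SolvesKeyEq S K f φ) (hf : f ≠ 0) {c : F} (hc : c ≠ 0) :
    SolvesKeyEq S K (algebraMap F _ c * f) (algebraMap F _ c * φ) := by
  have hcf : algebraMap F (CoordRing F q) c * f ≠ 0 :=
    mul_ne_zero ((map_ne_zero_iff _ (algebraMap F (CoordRing F q)).injective).2 hc) hf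
  rw [solvesKeyEq_iff_of_ne_zero hf] at h
  obtain ⟨⟨μ, hμ⟩, hφ⟩ := h
  rw [solvesKeyEq_iff_of_ne_zero hcf]
  exact ⟨⟨c * μ, hμ.keyDiff_const_mul c⟩, hφ.const_mul c⟩

theorem x_pow_mul_sub (hf : SolvesKeyEq S K f φ) (hg : SolvesKeyEq S L g ψ) (hf0 : f ≠ 0) {μ : F}
    (hl : HasLead (keyDiff S f φ) ((q : ℤ) ^ 2 - q - 1 - K) μ)
    (hl' : HasLead (keyDiff S g ψ) ((q : ℤ) ^ 2 - q - 1 - L) 1) {k l : ℕ}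
    (hkl : (k * q - K : ℤ) = l * q - L)
    (hne : x ^ k * f - algebraMap F _ μ * x ^ l * g ≠ 0) :
    SolvesKeyEq S (K - k * q + 1) (x ^ k * f - algebraMap F _ μ * x ^ l * g)
      (x ^ k * φ - algebraMap F _ μ * x ^ l * ψ) := by
  rw [solvesKeyEq_iff_of_ne_zero hf0] at hf
  rw [solvesKeyEq_iff_of_ne_zero hne, keyDiff_mul_sub_mul]
  constructor
  · have hcancel := hl.x_pow_mul_sub hl' (k := k) (l := l) (by linear_combination hkl) μ
    rw [mul_one, sub_self] at hcancel
    convert hcancel.exists_sub_one using 3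
    ring
  · rw [sub_eq_add_neg, mul_assoc]
    exact ((hf.2.x_pow_mul k).mono (by linarith)).add
      (((hg.starTermsAtLeast.x_pow_mul l).const_mul μ).neg.mono (by linarith))

end SolvesKeyEq

end KeyEquation

/-! ### One iteration of the algorithm -/

section Iteration

variable [Finite F] (e : Point F q → F) (m : ℕ) (s : State F q) (i : Fin q)

omit [Finite F] in
theorem State.p_partner (m : ℕ) (s : State F q) (i : Fin q) : s.p m (partner m i) = s.p m i := by
  rw [State.p, State.p, partner_partner, add_comm (s.d _)]

open Classical in
/-- The exponent of `x` in the top left entry of `U_i`: iteration `m` raises the order of `f_i`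
by `q` times this number. -/
def State.shift : ℕ :=
  if s.μ e m i = 0 then 0 else (-s.p m i).toNat

theorem State.shift_eq_zero_iff : s.shift e m i = 0 ↔ s.μ e m i = 0 ∨ 0 ≤ s.p m i := by
  rw [State.shift]
  split_ifs with hμ
  · exact iff_of_true rfl (Or.inl hμ)
  · rw [Int.toNat_eq_zero, neg_nonpos, or_iff_right hμ]

theorem State.step_f_φ_of_μ_eq_zero (h : s.μ e m i = 0) :
    (s.step e m).f i = s.f i ∧ (s.step e m).φ i = s.φ i := by
  simp only [State.step, State.B, State.U]
  rw [if_pos (Or.inl h), h]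
  simp [Matrix.mul_apply, Fin.sum_univ_two]

theorem State.step_f_φ_of_μ_ne_zero (h : s.μ e m i ≠ 0) :
    (s.step e m).f i = x ^ s.shift e m i * s.f i -
        algebraMap F _ (s.μ e m i) * x ^ (s.p m i).toNat * s.g (partner m i) ∧
      (s.step e m).φ i = x ^ s.shift e m i * s.φ i -
        algebraMap F _ (s.μ e m i) * x ^ (s.p m i).toNat * s.ψ (partner m i) := by
  simp only [State.step, State.B, State.U]
  rw [State.shift, if_neg h]
  rcases le_or_gt 0 (s.p m i) with hp | hp
  · rw [if_pos (Or.inr hp), Int.toNat_of_nonpos (neg_nonpos.2 hp)]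
    simp [Matrix.mul_apply, Fin.sum_univ_two, sub_eq_add_neg]
  · rw [if_neg (not_or.2 ⟨h, hp.not_ge⟩), Int.toNat_of_nonpos hp.le]
    simp [Matrix.mul_apply, Fin.sum_univ_two, sub_eq_add_neg]

theorem State.step_g_ψ_of_shift_eq_zero (h : s.shift e m (partner m i) = 0) :
    (s.step e m).g i = s.g i ∧ (s.step e m).ψ i = s.ψ i := by
  simp only [State.step, State.B, State.U]
  rw [if_pos ((s.shift_eq_zero_iff e m _).1 h), partner_partner]
  simp [Matrix.mul_apply, Fin.sum_univ_two]

theorem State.step_g_ψ_of_shift_ne_zero (h : s.shift e m (partner m i) ≠ 0) :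
    (s.step e m).g i = algebraMap F _ (s.μ e m (partner m i))⁻¹ * s.f (partner m i) ∧
      (s.step e m).ψ i = algebraMap F _ (s.μ e m (partner m i))⁻¹ * s.φ (partner m i) := by
  simp only [State.step, State.B, State.U]
  rw [if_neg ((s.shift_eq_zero_iff e m _).not.1 h)]
  simp [Matrix.mul_apply, Fin.sum_univ_two]

end Iteration

/-! ### The invariant of the algorithm -/

section Invariant

variable [Finite F] {e : Point F q → F} {m : ℕ} {s : State F q}

/-- The properties of the data `s` that the algorithm has before iteration `m`. Being monic of a
given order, and having order below a given bound, are expressed by `HasLead`. -/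
structure Invariant (e : Point F q → F) (m : ℕ) (s : State F q) : Prop where
  hasLead_f (i : Fin q) : HasLead (ι (s.f i)) (s.d i) 1
  modEq (i : Fin q) : s.d i ≡ (i : ℕ) [ZMOD q]
  solves_f (i : Fin q) : SolvesKeyEq (syndrome e) (m - s.d i) (s.f i) (s.φ i)
  solves_g (i : Fin q) : SolvesKeyEq (syndrome e) (s.d i - q) (s.g i) (s.ψ i)
  hasLead_keyDiff_g (i : Fin q) :
    HasLead (keyDiff (syndrome e) (s.g i) (s.ψ i)) ((q : ℤ) ^ 2 - 1 - s.d i) 1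
  hasLead_g (i : Fin q) : HasLead (ι (s.g i)) (m - s.d i + q) 0

omit [Finite F] in
theorem HasLead.ord_eq {f : CoordRing F q} {N : ℤ} {α : F} (hl : HasLead (ι f) N α) (hα : α ≠ 0) :
    ord f = N := by
  rw [ord, hl.rho_eq hα, WithBot.unbotD_coe]

variable (e) in
theorem invariant_run_zero : Invariant e 0 (run e 0) := by
  have hlead (i : Fin q) : HasLead (ι ((run e 0).f i)) ((i : ℕ) * (q + 1)) 1 := by
    simpa only [run, map_pow, one_pow] using (hasLead_y (F := F)).pow i
  have hd (i : Fin q) : (run e 0).d i = (i : ℕ) * (q + 1) := (hlead i).ord_eq one_ne_zero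
  have hf (i : Fin q) : (run e 0).f i ≠ 0 := fun h =>
    (hlead i).ne_zero one_ne_zero (by rw [h, map_zero])
  refine ⟨fun i => hd i ▸ hlead i, fun i => ?_, fun i => ?_, fun i => ?_, fun i => ?_, fun i => ?_⟩
  · rw [hd]
    exact Int.modEq_iff_dvd.2 ⟨-(i : ℕ), by ring⟩
  · rw [solvesKeyEq_iff_of_ne_zero (hf i), hd]
    have hkeyDiff : keyDiff (syndrome e) ((run e 0).f i) 0 = ι ((run e 0).f i) * syndrome e := by
      rw [keyDiff, map_zero, sub_zero]
    have hord : (q : ℤ) ^ 2 - q - 1 - ((0 : ℕ) - (i : ℕ) * (q + 1)) =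
        (i : ℕ) * (q + 1) + (q ^ 2 - q - 1) := by
      push_cast
      ring
    rw [hord]
    exact ⟨⟨_, hkeyDiff ▸ (hlead i).mul (hasLead_syndrome e)⟩, StarTermsAtLeast.zero _⟩
  · rw [hd]
    exact Or.inr ⟨rfl, -1, i, neg_one_lt_zero, by ring, Or.inr (by simp [run])⟩
  · have hkeyDiff : keyDiff (syndrome e) 0 (-zstar i) = ι (zstar i) := by
      rw [keyDiff, map_zero, zero_mul, map_neg, zero_sub, neg_neg]
    have hord : (q : ℤ) ^ 2 - 1 - (i : ℕ) * (q + 1) = termOrder 0 i := by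
      rw [termOrder]
      ring
    rw [hd, hord]
    exact hkeyDiff ▸ hasLead_zstar i
  · exact (map_zero ι).symm ▸ HasLead.zero _

namespace Invariant

variable (H : Invariant e m s) (i : Fin q)
include H

theorem f_ne_zero : s.f i ≠ 0 := fun h =>
  (H.hasLead_f i).ne_zero one_ne_zero (by rw [h, map_zero])

theorem dvd_d_add_d_partner_sub : (q : ℤ) ∣ s.d i + s.d (partner m i) - m := by
  refine Int.ModEq.dvd (((H.modEq i).add (H.modEq _)).trans ?_).symm
  exact_mod_cast Int.natCast_modEq_iff.2 (partner_spec m i)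

theorem p_mul : s.p m i * q = s.d i + s.d (partner m i) - m - q := by
  rw [State.p, sub_mul, Int.ediv_mul_cancel (H.dvd_d_add_d_partner_sub i), one_mul]

theorem r_mul : s.r m i * q = m - s.d i - (partner m i : ℕ) * (q + 1) := by
  rw [State.r, Int.ediv_mul_cancel]
  obtain ⟨u, hu⟩ := H.dvd_d_add_d_partner_sub i
  obtain ⟨v, hv⟩ := (H.modEq (partner m i)).dvd
  exact ⟨-u - v - (partner m i : ℕ), by linear_combination -hu - hv⟩

theorem hasLead_keyDiff_f :
    HasLead (keyDiff (syndrome e) (s.f i) (s.φ i)) ((q : ℤ) ^ 2 - q - 1 - (m - s.d i))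
      (s.μ e m i) := by
  obtain ⟨⟨α, hα⟩, hφ⟩ := (solvesKeyEq_iff_of_ne_zero (H.f_ne_zero i)).1 (H.solves_f i)
  have hord : (q : ℤ) ^ 2 - q - 1 - (m - s.d i) = termOrder (-1 - s.r m i) (partner m i) := by
    rw [termOrder]
    linear_combination H.r_mul i
  have hμ : s.μ e m i = α :=
    discrepancy_eq e (hord ▸ hα) (hφ.mono (by linarith))
  exact hμ ▸ hα

theorem μ_partner (hp : s.p m i < 0) : s.μ e m (partner m i) = s.μ e m i := by
  have hpq := H.p_mul i
  refine eq_of_hasLead_keyDiff (H.hasLead_f _) (H.hasLead_f _) (H.hasLead_keyDiff_f _)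
    (H.hasLead_keyDiff_f _) hp ?_ ?_ <;>
  · rw [termOrder, Fin.val_zero]
    push_cast
    linear_combination -hpq

theorem shift_partner : s.shift e m (partner m i) = s.shift e m i := by
  rcases le_or_gt 0 (s.p m i) with hp | hp
  · rw [(s.shift_eq_zero_iff e m i).2 (Or.inr hp),
      (s.shift_eq_zero_iff e m _).2 (Or.inr (hp.trans_eq (State.p_partner m s i).symm))]
  · rw [State.shift, State.shift, H.μ_partner i hp, State.p_partner]

theorem shift_mul_of_ne_zero (h : s.shift e m i ≠ 0) :
    (s.shift e m i * q : ℤ) = m + q - s.d i - s.d (partner m i) := by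
  obtain ⟨hμ, hp⟩ := not_or.1 ((s.shift_eq_zero_iff e m i).not.1 h)
  rw [State.shift, if_neg hμ, Int.toNat_of_nonneg (by omega), neg_mul, H.p_mul]
  ring

theorem shift_mul_sub_of_μ_ne_zero (h : s.μ e m i ≠ 0) :
    (s.shift e m i * q - (s.p m i).toNat * q : ℤ) = m + q - s.d i - s.d (partner m i) := by
  have hp : ((-s.p m i).toNat - (s.p m i).toNat : ℤ) = -s.p m i := by omega
  rw [State.shift, if_neg h]
  linear_combination q * hp - H.p_mul i

theorem hasLead_step_f : HasLead (ι ((s.step e m).f i)) (s.d i + s.shift e m i * q) 1 := by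
  by_cases hμ : s.μ e m i = 0
  · rw [(s.step_f_φ_of_μ_eq_zero e m i hμ).1, (s.shift_eq_zero_iff e m i).2 (Or.inl hμ),
      Nat.cast_zero, zero_mul, add_zero]
    exact H.hasLead_f i
  · have hN := H.shift_mul_sub_of_μ_ne_zero i hμ
    have := (H.hasLead_f i).x_pow_mul_sub (H.hasLead_g (partner m i)) (k := s.shift e m i)
      (l := (s.p m i).toNat) (by linear_combination hN) (s.μ e m i)
    rw [(s.step_f_φ_of_μ_ne_zero e m i hμ).1, map_sub, map_mul, map_mul _ _ (s.g _), add_comm]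
    rwa [mul_zero, sub_zero] at this

theorem d_step : (s.step e m).d i = s.d i + s.shift e m i * q :=
  (H.hasLead_step_f i).ord_eq one_ne_zero

theorem solves_step_f :
    SolvesKeyEq (syndrome e) ((m + 1 : ℕ) - (s.step e m).d i) ((s.step e m).f i)
      ((s.step e m).φ i) := by
  have hne : (s.step e m).f i ≠ 0 := fun h =>
    (H.hasLead_step_f i).ne_zero one_ne_zero (by rw [h, map_zero])
  rw [H.d_step, Nat.cast_add_one]
  by_cases hμ : s.μ e m i = 0
  · obtain ⟨hf, hφ⟩ := s.step_f_φ_of_μ_eq_zero e m i hμ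
    rw [hf, hφ, (s.shift_eq_zero_iff e m i).2 (Or.inl hμ), Nat.cast_zero, zero_mul, add_zero,
      add_sub_right_comm]
    exact (H.solves_f i).add_one (H.f_ne_zero i) (hμ ▸ H.hasLead_keyDiff_f i)
  · obtain ⟨hf, hφ⟩ := s.step_f_φ_of_μ_ne_zero e m i hμ
    have hkl := H.shift_mul_sub_of_μ_ne_zero i hμ
    have hlead : HasLead (keyDiff (syndrome e) (s.g (partner m i)) (s.ψ (partner m i)))
        ((q : ℤ) ^ 2 - q - 1 - (s.d (partner m i) - q)) 1 := by
      convert H.hasLead_keyDiff_g (partner m i) using 1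
      ring
    rw [hf] at hne
    rw [hf, hφ]
    convert (H.solves_f i).x_pow_mul_sub (H.solves_g (partner m i)) (H.f_ne_zero i)
      (H.hasLead_keyDiff_f i) hlead (by linear_combination hkl) hne using 1
    ring

theorem solves_step_g :
    SolvesKeyEq (syndrome e) ((s.step e m).d i - q) ((s.step e m).g i) ((s.step e m).ψ i) := by
  have hshift := H.shift_partner i
  rw [H.d_step]
  by_cases h : s.shift e m i = 0
  · obtain ⟨hg, hψ⟩ := s.step_g_ψ_of_shift_eq_zero e m i (hshift.trans h)
    rw [hg, hψ, h, Nat.cast_zero, zero_mul, add_zero]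
    exact H.solves_g i
  · have hj : s.shift e m (partner m i) ≠ 0 := hshift.trans_ne h
    obtain ⟨hg, hψ⟩ := s.step_g_ψ_of_shift_ne_zero e m i hj
    have hμ := (not_or.1 ((s.shift_eq_zero_iff e m _).not.1 hj)).1
    rw [hg, hψ, H.shift_mul_of_ne_zero i h]
    convert (H.solves_f (partner m i)).const_mul (H.f_ne_zero _) (inv_ne_zero hμ) using 1
    ring

theorem hasLead_keyDiff_step_g :
    HasLead (keyDiff (syndrome e) ((s.step e m).g i) ((s.step e m).ψ i))
      ((q : ℤ) ^ 2 - 1 - (s.step e m).d i) 1 := by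
  have hshift := H.shift_partner i
  rw [H.d_step]
  by_cases h : s.shift e m i = 0
  · obtain ⟨hg, hψ⟩ := s.step_g_ψ_of_shift_eq_zero e m i (hshift.trans h)
    rw [hg, hψ, h, Nat.cast_zero, zero_mul, add_zero]
    exact H.hasLead_keyDiff_g i
  · have hj : s.shift e m (partner m i) ≠ 0 := hshift.trans_ne h
    obtain ⟨hg, hψ⟩ := s.step_g_ψ_of_shift_ne_zero e m i hj
    have hμ := (not_or.1 ((s.shift_eq_zero_iff e m _).not.1 hj)).1
    rw [hg, hψ, H.shift_mul_of_ne_zero i h]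
    convert (H.hasLead_keyDiff_f (partner m i)).keyDiff_const_mul (s.μ e m (partner m i))⁻¹ using 1
    · ring
    · exact (inv_mul_cancel₀ hμ).symm

theorem hasLead_step_g :
    HasLead (ι ((s.step e m).g i)) ((m + 1 : ℕ) - (s.step e m).d i + q) 0 := by
  have hshift := H.shift_partner i
  rw [H.d_step]
  by_cases h : s.shift e m i = 0
  · rw [(s.step_g_ψ_of_shift_eq_zero e m i (hshift.trans h)).1]
    exact (H.hasLead_g i).of_lt (by rw [h]; push_cast; linarith)
  · rw [(s.step_g_ψ_of_shift_ne_zero e m i (hshift.trans_ne h)).1, map_mul,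
      H.shift_mul_of_ne_zero i h]
    exact ((H.hasLead_f (partner m i)).const_mul _).of_lt (by push_cast; linarith)

theorem step : Invariant e (m + 1) (s.step e m) where
  hasLead_f i := H.d_step i ▸ H.hasLead_step_f i
  modEq i := by
    rw [H.d_step]
    exact (Int.modEq_iff_dvd.2 ⟨-(s.shift e m i), by ring⟩).trans (H.modEq i)
  solves_f := H.solves_step_f
  solves_g := H.solves_step_g
  hasLead_keyDiff_g := H.hasLead_keyDiff_step_g
  hasLead_g := H.hasLead_step_g

end Invariant

variable (e) in
theorem invariant_run (m : ℕ) : Invariant e m (run e m) := by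
  induction m with
  | zero => exact invariant_run_zero e
  | succ m ih => exact ih.step

end Invariant

end FunctionField

end

end Hermitian

open Hermitian in
theorem mainTheorem2_general {F : Type*} [Field F] [Finite F] {q : ℕ} [Fact (IsPrimePow q)]
    (e : Point F q → F) (m : ℕ) (i : Fin q) :
    ∃ d : ℤ, rho ((run e m).f i) = (d : WithBot ℤ) ∧
      IsStarMonic (algebraMap (CoordRing F q) (FunField F q) ((run e m).f i)) ∧
      d ≡ (i : ℕ) [ZMOD q] ∧
      SolvesKeyEq (syndrome e) (m - d) ((run e m).f i) ((run e m).φ i) ∧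
      SolvesKeyEq (syndrome e) (d - q) ((run e m).g i) ((run e m).ψ i) ∧
      IsStarMonic (keyDiff (syndrome e) ((run e m).g i) ((run e m).ψ i)) ∧
      rhoFrac (keyDiff (syndrome e) ((run e m).g i) ((run e m).ψ i)) =
        (((q : ℤ) ^ 2 - 1 - d : ℤ) : WithBot ℤ) ∧
      rho ((run e m).g i) < ((m - d + q : ℤ) : WithBot ℤ) := by
  have H := invariant_run e m
  obtain ⟨c, hc, -⟩ := hasZeroCoord_algebraMap ((run e m).f i)
  obtain ⟨c', hc'⟩ := exists_isStarExpansion_keyDiff e ((run e m).g i) ((run e m).ψ i)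
  have hlead := H.hasLead_keyDiff_g i
  exact ⟨(run e m).d i, (H.hasLead_f i).rho_eq one_ne_zero, hc.isStarMonic (H.hasLead_f i),
    H.modEq i, H.solves_f i, H.solves_g i, hc'.isStarMonic hlead, hlead.rhoFrac_eq one_ne_zero,
    (H.hasLead_g i).rho_lt⟩

open Hermitian in
theorem mainTheorem2 {F : Type*} [Field F] [Finite F] {q : ℕ} [Fact (IsPrimePow q)]
    (hF : Nat.card F = q ^ 2) (e : Point F q → F) (m : ℕ) (i : Fin q) :
    ∃ d : ℤ, rho ((run e m).f i) = (d : WithBot ℤ) ∧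
      IsStarMonic (algebraMap (CoordRing F q) (FunField F q) ((run e m).f i)) ∧
      d ≡ (i : ℕ) [ZMOD q] ∧
      SolvesKeyEq (syndrome e) (m - d) ((run e m).f i) ((run e m).φ i) ∧
      SolvesKeyEq (syndrome e) (d - q) ((run e m).g i) ((run e m).ψ i) ∧
      IsStarMonic (keyDiff (syndrome e) ((run e m).g i) ((run e m).ψ i)) ∧
      rhoFrac (keyDiff (syndrome e) ((run e m).g i) ((run e m).ψ i)) =
        (((q : ℤ) ^ 2 - 1 - d : ℤ) : WithBot ℤ) ∧
      rho ((run e m).g i) < ((m - d + q : ℤ) : WithBot ℤ) :=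
  mainTheorem2_general e m i
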